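/- Conventions. An MV-algebra $\langle A,\oplus,{}^*,0\rangle$ is a commutative monoid with an involution ${}^*$ satisfying $x\oplus 0^*=0^*$ and $(x^*\oplus y)^*\oplus y=(y^*\oplus x)^*\oplus x$; put $1=0^*$, $x\odot y=(x^*\oplus y^*)^*$, $x\ominus y=x\odot y^*$, $d(x,y)=(x\ominus y)\oplus(y\ominus x)$, and $x\le y$ iff $x^*\oplus y=1$. The interval $[0,1]$ carries $x\oplus y=\min(1,x+y)$, $x^*=1-x$, and $[0,1]^X$ the pointwise operations. An ideal is a downward closed subset containing $0$ and closed under $\oplus$. $A$ is simple if $\{0\}$ is its only proper ideal, and semisimple if it is a subdirect product of simple MV-algebras. Let $\operatorname{Max}A$ be the set of maximal ideals of $A$. For $M\in\operatorname{Max}A$ there is a unique embedding $\iota_M:A/M\to[0,1]$; for $a\in A$ let $\hat a\in[0,1]^{\operatorname{Max}A}$ be $\hat a(M)=\iota_M(a/M)$, and $\hat A=\{\hat a: a\in A\}$. A subset $X\subseteq A$ is a cut if $X=luX$, where $u$ and $l$ denote the sets of upper and of lower bounds in $A$. For $A$ semisimple, a cut $X$ is a limit cut if $\bigwedge\{d(\hat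 a,\hat b): a\in X,\ b\in uX\}=\mathbf 0$ in $[0,1]^{\operatorname{Max}A}$; $A$ is limit cut complete (lcc) if it is semisimple and each of its limit cuts has a supremum in $A$. The limit cut completion $A^{\mathrm{lcc}}$ of a semisimple MV-algebra $A$ is the intersection of all subalgebras of $[0,1]^{\operatorname{Max}A}$ that are lcc and contain $\hat A$. An MV-topology on a set $X$ is a family $\Omega\subseteq[0,1]^X$ (the open sets) containing $\mathbf 0,\mathbf 1$ and closed under arbitrary joins and under binary $\odot,\oplus,\wedge$; the closed sets are the $o^*$ with $o\in\Omega$; a map $f:X\to Y$ between MV-topological spaces is continuous if $o\circ f$ is open for every open $o$ of $Y$. $\operatorname{Clop}$ sends an MV-topological space to the subalgebra of $[0,1]^X$ of the fuzzy sets that are both open and closed, and a continuous map $f$ to $\alpha\mapsto\alpha\circ f$. $\operatorname{Max}$ sends an MV-algebra $A$ to $\operatorname{Max}A$ with the MV-topology $\Omega_A$ of all joins of families of elements of $\hat A$, and a homomorphism $h:A\to B$ to the continuous map $\operatorname{Max}B\to\operatorname{Max}A$, $N\mapsto h^{-1}[N]$. Let $\mathcal{MV}^{\mathrm{ss}}$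 be the category of semisimple MV-algebras and MV-homomorphisms, and $\mathcal{MV}^{\mathrm{lcc}}$ its full subcategory of lcc MV-algebras. Theorem 5.7. (1) For every semisimple MV-algebra $A$, the algebra $A^{\mathrm{lcc}}$ is itself lcc and contains $\hat A$, so it is the smallest lcc subalgebra of $[0,1]^{\operatorname{Max}A}$ containing $\hat A$; moreover $A^{\mathrm{lcc}}=\operatorname{Clop}\operatorname{Max}A$. (2) The assignment $A\mapsto A^{\mathrm{lcc}}=\operatorname{Clop}\operatorname{Max}A$ on objects and $f\mapsto f^{\mathrm{lcc}}=\operatorname{Clop}\operatorname{Max}f$ on morphisms is a functor $(\ )^{\mathrm{lcc}}:\mathcal{MV}^{\mathrm{ss}}\to\mathcal{MV}^{\mathrm{lcc}}$ which is faithful and left adjoint to the inclusion $\mathcal{MV}^{\mathrm{lcc}}\hookrightarrow\mathcal{MV}^{\mathrm{ss}}$, with unit $A\to A^{\mathrm{lcc}}$, $a\mapsto\hat a$. That is, $(\ )^{\mathrm{lcc}}$ is a faithful reflection. -/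

import Mathlib

open CategoryTheory

universe u v

/-- An MV-algebra `⟨A, ⊕, *, 0⟩`. -/
class MVAlgebra (A : Type u) where
  oplus : A → A → A
  neg : A → A
  zero : A
  oplus_assoc : ∀ x y z : A, oplus (oplus x y) z = oplus x (oplus y z)
  oplus_comm : ∀ x y : A, oplus x y = oplus y x
  oplus_zero : ∀ x : A, oplus x zero = x
  neg_neg : ∀ x : A, neg (neg x) = x
  oplus_neg_zero : ∀ x : A, oplus x (neg zero) = neg zero
  luk : ∀ x y : A, oplus (neg (oplus (neg x) y)) y = oplus (neg (oplus (neg y) x)) x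

namespace MVAlgebra

infixl:65 " ⊕ₘ " => MVAlgebra.oplus
prefix:max "∼" => MVAlgebra.neg

section basic

variable {A : Type u} [MVAlgebra A]

/-- `1 = 0*`. -/
def one (A : Type u) [MVAlgebra A] : A := ∼(zero : A)

/-- `x ⊙ y = (x* ⊕ y*)*`. -/
def odot (x y : A) : A := ∼(∼x ⊕ₘ ∼y)

/-- `x ⊖ y = x ⊙ y*`. -/
def ominus (x y : A) : A := odot x ∼y

/-- Chang's distance `d(x, y) = (x ⊖ y) ⊕ (y ⊖ x)`. -/
def dist (x y : A) : A := ominus x y ⊕ₘ ominus y x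

/-- The natural order: `x ≤ y` iff `x* ⊕ y = 1`. -/
def le (x y : A) : Prop := ∼x ⊕ₘ y = one A

infixl:70 " ⊙ₘ " => MVAlgebra.odot
infixl:65 " ⊖ₘ " => MVAlgebra.ominus
infix:50 " ≤ₘ " => MVAlgebra.le

/-- `n x = x ⊕ ⋯ ⊕ x` (`n` times). -/
def mul : ℕ → A → A
  | 0, _ => zero
  | n + 1, x => mul n x ⊕ₘ x

instance : Std.Associative (oplus : A → A → A) := ⟨oplus_assoc⟩
instance : Std.Commutative (oplus : A → A → A) := ⟨oplus_comm⟩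

theorem zero_oplus (x : A) : zero ⊕ₘ x = x := by rw [oplus_comm, oplus_zero]
theorem oplus_one (x : A) : x ⊕ₘ one A = one A := oplus_neg_zero x
theorem one_oplus (x : A) : one A ⊕ₘ x = one A := by rw [oplus_comm, oplus_one]
theorem neg_one : ∼(one A) = zero := neg_neg _
theorem neg_zero : ∼(zero : A) = one A := rfl
theorem neg_inj {x y : A} (h : ∼x = ∼y) : x = y := by rw [← neg_neg x, h, neg_neg]
theorem ominus_eq (x y : A) : x ⊖ₘ y = ∼(∼x ⊕ₘ y) := by rw [ominus, odot, neg_neg]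
theorem odot_comm (x y : A) : x ⊙ₘ y = y ⊙ₘ x := by rw [odot, odot, oplus_comm]
theorem odot_assoc (x y z : A) : x ⊙ₘ y ⊙ₘ z = x ⊙ₘ (y ⊙ₘ z) := by
  simp only [odot, neg_neg, oplus_assoc]
theorem neg_oplus (x y : A) : ∼(x ⊕ₘ y) = ∼x ⊙ₘ ∼y := by simp only [odot, neg_neg]
theorem neg_odot (x y : A) : ∼(x ⊙ₘ y) = ∼x ⊕ₘ ∼y := by simp only [odot, neg_neg]

theorem le_refl (x : A) : x ≤ₘ x := by
  have h := luk x (one A)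
  rw [oplus_one (∼x), neg_one, zero_oplus, zero_oplus] at h
  exact h.symm

theorem neg_oplus_self (x : A) : ∼x ⊕ₘ x = one A := le_refl x
theorem oplus_neg_self (x : A) : x ⊕ₘ ∼x = one A := by rw [oplus_comm]; exact le_refl x
theorem odot_neg_self (x : A) : x ⊙ₘ ∼x = zero := by
  rw [odot, neg_neg, neg_oplus_self, neg_one]
theorem ominus_self (x : A) : x ⊖ₘ x = zero := odot_neg_self x
theorem odot_one (x : A) : x ⊙ₘ one A = x := by rw [odot, neg_one, oplus_zero, neg_neg]
theorem odot_zero (x : A) : x ⊙ₘ zero = zero := by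
  rw [odot, neg_zero, oplus_one, neg_one]
theorem zero_ominus (x : A) : zero ⊖ₘ x = zero := by
  rw [ominus, odot_comm, odot_zero]

theorem ominus_eq_zero_iff {x y : A} : x ⊖ₘ y = zero ↔ x ≤ₘ y := by
  rw [ominus_eq, le]
  constructor
  · intro h; rw [← neg_neg (∼x ⊕ₘ y), h, neg_zero]
  · intro h; rw [h, neg_one]

theorem le_oplus_left (x y : A) : x ≤ₘ x ⊕ₘ y := by
  rw [le, ← oplus_assoc, neg_oplus_self, one_oplus]

/-- If `y ≤ x`, then `(x ⊖ y) ⊕ y = x`. -/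
theorem ominus_oplus {x y : A} (h : y ≤ₘ x) : x ⊖ₘ y ⊕ₘ y = x := by
  rw [ominus_eq, luk, show ∼y ⊕ₘ x = one A from h, neg_one, zero_oplus]

/-- If `x ⊙ z = 0`, then `(x ⊕ z) ⊖ z = x`. -/
theorem oplus_ominus {x z : A} (h : x ≤ₘ ∼z) : x ⊕ₘ z ⊖ₘ z = x := by
  have h' : ∼z ⊕ₘ ∼x = one A := by rw [oplus_comm]; exact h
  have := luk (∼x) z
  rw [h', neg_one, zero_oplus, neg_neg] at this
  rw [ominus_eq, this, neg_neg]

theorem le_antisymm {x y : A} (h : x ≤ₘ y) (h' : y ≤ₘ x) : x = y := by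
  have := ominus_oplus h
  rw [ominus_eq_zero_iff.2 h', zero_oplus] at this
  exact this

theorem le_trans {x y z : A} (h : x ≤ₘ y) (h' : y ≤ₘ z) : x ≤ₘ z := by
  have : z = x ⊕ₘ (z ⊖ₘ y ⊕ₘ (y ⊖ₘ x)) := by
    conv => lhs; rw [← ominus_oplus h']
    conv => lhs; rhs; rw [← ominus_oplus h]
    ac_rfl
  rw [this]; exact le_oplus_left _ _

theorem zero_le (x : A) : zero ≤ₘ x := by rw [le, neg_zero, one_oplus]
theorem le_one (x : A) : x ≤ₘ one A := oplus_one _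

theorem le_zero {x : A} (h : x ≤ₘ zero) : x = zero := le_antisymm h (zero_le x)
theorem one_le {x : A} (h : one A ≤ₘ x) : x = one A := le_antisymm (le_one x) h

theorem neg_le_neg {x y : A} (h : x ≤ₘ y) : ∼y ≤ₘ ∼x := by
  rw [le, neg_neg, oplus_comm]; exact h

theorem le_neg_comm {x y : A} (h : x ≤ₘ ∼y) : y ≤ₘ ∼x := by
  have := neg_le_neg h
  rwa [neg_neg] at this

theorem oplus_le_oplus_right {x y : A} (h : x ≤ₘ y) (z : A) : x ⊕ₘ z ≤ₘ y ⊕ₘ z := by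
  rw [← ominus_oplus h]
  have : y ⊖ₘ x ⊕ₘ x ⊕ₘ z = x ⊕ₘ z ⊕ₘ (y ⊖ₘ x) := by ac_rfl
  rw [this]; exact le_oplus_left _ _

theorem oplus_le_oplus {x y z w : A} (h : x ≤ₘ y) (h' : z ≤ₘ w) : x ⊕ₘ z ≤ₘ y ⊕ₘ w := by
  refine le_trans (oplus_le_oplus_right h z) ?_
  rw [oplus_comm y z, oplus_comm y w]; exact oplus_le_oplus_right h' y

theorem odot_le_odot {x y z w : A} (h : x ≤ₘ y) (h' : z ≤ₘ w) : x ⊙ₘ z ≤ₘ y ⊙ₘ w :=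
  neg_le_neg (oplus_le_oplus (neg_le_neg h) (neg_le_neg h'))

theorem ominus_le_iff {x y z : A} : x ⊖ₘ y ≤ₘ z ↔ x ≤ₘ y ⊕ₘ z := by
  rw [le, le, ominus_eq, neg_neg, oplus_assoc]

theorem odot_le_left (x y : A) : x ⊙ₘ y ≤ₘ x := by
  have := odot_le_odot (le_refl x) (le_one y)
  rwa [odot_one] at this

theorem ominus_le (x y : A) : x ⊖ₘ y ≤ₘ x := odot_le_left _ _

theorem ominus_ominus (x y z : A) : x ⊖ₘ y ⊖ₘ z = x ⊖ₘ (y ⊕ₘ z) := by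
  simp only [ominus_eq, neg_neg, oplus_assoc]

theorem ominus_ominus_self {x y : A} (h : y ≤ₘ x) : x ⊖ₘ (x ⊖ₘ y) = y := by
  have h1 : y ≤ₘ ∼(x ⊖ₘ y) := by
    rw [ominus, neg_odot, neg_neg, oplus_comm]; exact le_oplus_left _ _
  have := oplus_ominus h1
  rwa [oplus_comm, ominus_oplus h] at this

theorem ominus_le_ominus {x y : A} (h : x ≤ₘ y) (z : A) : x ⊖ₘ z ≤ₘ y ⊖ₘ z :=
  odot_le_odot h (le_refl _)

theorem oplus_eq_one_iff {x y : A} : x ⊕ₘ y = one A ↔ ∼x ≤ₘ y := by rw [le, neg_neg]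

theorem odot_eq_zero_iff {x y : A} : x ⊙ₘ y = zero ↔ x ≤ₘ ∼y := by
  rw [← ominus_eq_zero_iff, ominus, neg_neg]

/-- `(x ⊖ y) ∧ (y ⊖ x) = 0`. -/
theorem prelinear {x y t : A} (h1 : t ≤ₘ x ⊖ₘ y) (h2 : t ≤ₘ y ⊖ₘ x) : t = zero := by
  set j := x ⊖ₘ y ⊕ₘ y with hj
  have hj' : j = y ⊖ₘ x ⊕ₘ x := by rw [hj, ominus_eq, ominus_eq, luk]
  have hy : t ≤ₘ ∼y := le_trans h1 (by rw [ominus, odot_comm]; exact odot_le_left _ _)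
  have hx : t ≤ₘ ∼x := le_trans h2 (by rw [ominus, odot_comm]; exact odot_le_left _ _)
  have hyj : y ≤ₘ j ⊖ₘ t := by
    have := ominus_le_ominus (oplus_le_oplus_right h1 y) t
    rwa [oplus_comm t y, oplus_ominus (le_neg_comm hy)] at this
  have hxj : x ≤ₘ j ⊖ₘ t := by
    have := ominus_le_ominus (oplus_le_oplus_right h2 x) t
    rwa [oplus_comm t x, oplus_ominus (le_neg_comm hx), ← hj'] at this
  have hjj : j ≤ₘ j ⊖ₘ t := by
    conv => lhs; rw [hj]
    refine le_trans (oplus_le_oplus_right (ominus_le_ominus hxj y) y) ?_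
    rw [ominus_oplus hyj]; exact le_refl _
  have htj : t ≤ₘ j :=
    le_trans h1 (by rw [hj]; exact le_oplus_left _ _)
  have h3 : t ≤ₘ ∼j := by
    refine le_neg_comm (le_trans hjj ?_)
    rw [ominus, odot_comm]; exact odot_le_left _ _
  have h4 : t ⊕ₘ j ≤ₘ j := by
    have := oplus_le_oplus_right hjj t
    rw [ominus_oplus htj] at this
    rwa [oplus_comm]
  have h5 := ominus_le_ominus h4 j
  rw [oplus_ominus h3, ominus_self] at h5
  exact le_zero h5

theorem disjoint_oplus {x y z : A} (h : ∀ t, t ≤ₘ x → t ≤ₘ y → t = zero)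
    (h' : ∀ t, t ≤ₘ x → t ≤ₘ z → t = zero) : ∀ t, t ≤ₘ x → t ≤ₘ y ⊕ₘ z → t = zero := by
  intro t ht ht'
  have h1 : t ⊖ₘ y = zero := h' _ (le_trans (ominus_le _ _) ht) (ominus_le_iff.2 ht')
  exact h t ht (ominus_eq_zero_iff.1 h1)

theorem disjoint_mul {x y : A} (h : ∀ t, t ≤ₘ x → t ≤ₘ y → t = zero) (n : ℕ) :
    ∀ t, t ≤ₘ x → t ≤ₘ mul n y → t = zero := by
  induction n with
  | zero => intro t _ ht; exact le_zero ht
  | succ n ih => exact disjoint_oplus ih h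

theorem mul_add (m n : ℕ) (x : A) : mul (m + n) x = mul m x ⊕ₘ mul n x := by
  induction n with
  | zero => simp only [mul, oplus_zero, Nat.add_zero]
  | succ n ih => rw [← Nat.add_assoc, mul, ih, mul, oplus_assoc]

end basic

end MVAlgebra

section homs_ideals

open MVAlgebra

/-- Homomorphisms of MV-algebras. -/
@[ext]
structure MVHom (A : Type u) (B : Type v) [MVAlgebra A] [MVAlgebra B] where
  toFun : A → B
  map_zero' : toFun zero = zero
  map_neg' : ∀ x, toFun ∼x = ∼(toFun x)
  map_oplus' : ∀ x y, toFun (x ⊕ₘ y) = toFun x ⊕ₘ toFun y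

namespace MVHom

variable {A B C : Type*} [MVAlgebra A] [MVAlgebra B] [MVAlgebra C]

instance : CoeFun (MVHom A B) (fun _ => A → B) := ⟨toFun⟩

theorem map_one (f : MVHom A B) : f (one A) = one B := by
  rw [one, f.map_neg', f.map_zero']; rfl

theorem map_odot (f : MVHom A B) (x y : A) : f (x ⊙ₘ y) = f x ⊙ₘ f y := by
  simp only [odot, f.map_neg', f.map_oplus']

theorem map_le (f : MVHom A B) {x y : A} (h : x ≤ₘ y) : f x ≤ₘ f y := by
  have := congrArg f h
  rwa [f.map_oplus', f.map_neg', f.map_one] at this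

theorem map_mul (f : MVHom A B) (n : ℕ) (x : A) : f (mul n x) = mul n (f x) := by
  induction n with
  | zero => exact f.map_zero'
  | succ n ih => rw [mul, f.map_oplus', ih, mul]

/-- The identity homomorphism. -/
def id (A : Type*) [MVAlgebra A] : MVHom A A := ⟨fun x => x, rfl, fun _ => rfl, fun _ _ => rfl⟩

/-- The composition `g ∘ f`. -/
def comp (g : MVHom B C) (f : MVHom A B) : MVHom A C where
  toFun x := g (f x)
  map_zero' := by rw [f.map_zero', g.map_zero']
  map_neg' x := by rw [f.map_neg', g.map_neg']
  map_oplus' x y := by rw [f.map_oplus', g.map_oplus']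

end MVHom

/-- Ideals of an MV-algebra. -/
@[ext]
structure MVIdeal (A : Type u) [MVAlgebra A] where
  carrier : Set A
  zero_mem : zero ∈ carrier
  oplus_mem : ∀ x ∈ carrier, ∀ y ∈ carrier, x ⊕ₘ y ∈ carrier
  lower : ∀ x y, x ≤ₘ y → y ∈ carrier → x ∈ carrier

namespace MVIdeal

variable {A : Type u} [MVAlgebra A]

/-- Proper ideals. -/
def IsProper (I : MVIdeal A) : Prop := I.carrier ≠ Set.univ

/-- Maximal ideals: the maximal elements among the proper ideals. -/
def IsMaximal (I : MVIdeal A) : Prop :=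
  I.IsProper ∧ ∀ J : MVIdeal A, J.IsProper → I.carrier ⊆ J.carrier → J = I

theorem isProper_iff (I : MVIdeal A) : I.IsProper ↔ one A ∉ I.carrier := by
  rw [IsProper, not_iff_not, Set.eq_univ_iff_forall]
  exact ⟨fun h => h _, fun h x => I.lower x _ (le_one x) h⟩

theorem mul_mem (I : MVIdeal A) {x : A} (h : x ∈ I.carrier) (n : ℕ) :
    mul n x ∈ I.carrier := by
  induction n with
  | zero => exact I.zero_mem
  | succ n ih => exact I.oplus_mem _ ih _ h

theorem IsMaximal.exists_mul {M : MVIdeal A} (hM : M.IsMaximal) {a : A} (ha : a ∉ M.carrier) :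
    ∃ n : ℕ, ∼(mul n a) ∈ M.carrier := by
  let J : MVIdeal A :=
    { carrier := {x | ∃ n : ℕ, ∃ m ∈ M.carrier, x ≤ₘ m ⊕ₘ mul n a}
      zero_mem := ⟨0, zero, M.zero_mem, zero_le _⟩
      oplus_mem := by
        rintro x ⟨n, m, hm, hx⟩ y ⟨n', m', hm', hy⟩
        refine ⟨n + n', m ⊕ₘ m', M.oplus_mem _ hm _ hm', ?_⟩
        have h := oplus_le_oplus hx hy
        have e : m ⊕ₘ mul n a ⊕ₘ (m' ⊕ₘ mul n' a) = m ⊕ₘ m' ⊕ₘ mul (n + n') a := by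
          rw [MVAlgebra.mul_add]; ac_rfl
        rwa [e] at h
      lower := by
        rintro x y hxy ⟨n, m, hm, hy⟩
        exact ⟨n, m, hm, le_trans hxy hy⟩ }
  by_cases hJ : J.IsProper
  · exfalso
    have hJM : J = M := hM.2 J hJ fun x hx => ⟨0, x, hx, le_oplus_left _ _⟩
    apply ha
    rw [← hJM]
    refine ⟨1, zero, M.zero_mem, ?_⟩
    simp only [mul, zero_oplus]; exact le_refl _
  · rw [isProper_iff, not_not] at hJ
    obtain ⟨n, m, hm, h⟩ := hJ
    refine ⟨n, M.lower _ m ?_ hm⟩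
    have h := one_le h
    rw [le, MVAlgebra.neg_neg, oplus_comm]; exact h

end MVIdeal

/-- The maximal spectrum `Max A`. -/
def MaxSpec (A : Type u) [MVAlgebra A] : Type u := {M : MVIdeal A // M.IsMaximal}

end homs_ideals

/-! ### The standard MV-algebra and fuzzy sets -/

noncomputable section standard

open MVAlgebra

theorem unitInterval_add_mem (x y : unitInterval) : min 1 ((x : ℝ) + y) ∈ unitInterval :=
  ⟨le_min zero_le_one (add_nonneg x.2.1 y.2.1), min_le_left _ _⟩

/-- The standard MV-algebra on `[0, 1]`: `x ⊕ y = min (1, x + y)` and `x* = 1 - x`. -/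
instance unitInterval.instMVAlgebra : MVAlgebra unitInterval where
  oplus x y := ⟨min 1 ((x : ℝ) + y), unitInterval_add_mem x y⟩
  neg x := ⟨1 - (x : ℝ), by constructor <;> linarith [x.2.1, x.2.2]⟩
  zero := ⟨0, by constructor <;> norm_num⟩
  oplus_assoc x y z := by
    ext
    have := x.2.1; have := y.2.1; have := z.2.1
    simp only
    grind
  oplus_comm x y := by ext; simp only; rw [add_comm]
  oplus_zero x := by ext; simp only [add_zero]; exact min_eq_right x.2.2
  neg_neg x := by ext; simp
  oplus_neg_zero x := by
    ext; simp only; rw [min_eq_left] <;> linarith [x.2.1]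
  luk x y := by
    ext
    have := x.2.1; have := y.2.1; have := x.2.2; have := y.2.2
    simp only
    grind

namespace unitInterval

theorem coe_oplus (x y : unitInterval) : ((x ⊕ₘ y : unitInterval) : ℝ) = min 1 ((x : ℝ) + y) := rfl
theorem coe_neg (x : unitInterval) : ((∼x : unitInterval) : ℝ) = 1 - x := rfl
theorem coe_mvzero : ((MVAlgebra.zero : unitInterval) : ℝ) = 0 := rfl
theorem coe_mvone : ((MVAlgebra.one unitInterval : unitInterval) : ℝ) = 1 := by
  rw [MVAlgebra.one, coe_neg, coe_mvzero, sub_zero]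
theorem coe_odot (x y : unitInterval) :
    ((x ⊙ₘ y : unitInterval) : ℝ) = max 0 ((x : ℝ) + y - 1) := by
  rw [MVAlgebra.odot, coe_neg, coe_oplus, coe_neg, coe_neg]
  grind

end unitInterval

/-- Pointwise MV-algebra structure on a product. -/
instance Pi.instMVAlgebra {X : Type*} {S : X → Type*} [∀ i, MVAlgebra (S i)] :
    MVAlgebra (∀ i, S i) where
  oplus f g i := f i ⊕ₘ g i
  neg f i := ∼(f i)
  zero _ := zero
  oplus_assoc _ _ _ := funext fun _ => oplus_assoc _ _ _
  oplus_comm _ _ := funext fun _ => oplus_comm _ _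
  oplus_zero _ := funext fun _ => oplus_zero _
  neg_neg _ := funext fun _ => MVAlgebra.neg_neg _
  oplus_neg_zero _ := funext fun _ => oplus_neg_zero _
  luk _ _ := funext fun _ => luk _ _

/-- The MV-algebra `[0, 1]^X` of fuzzy subsets of `X`. -/
abbrev FuzzySet (X : Type u) : Type u := X → unitInterval

/-! ### Evaluation at a maximal ideal

For every maximal ideal `M` of `A` there is exactly one homomorphism `A → [0, 1]` with kernel `M`.
Existence is obtained by embedding the simple quotient `A / M`, a chain, into an archimedean
ordered abelian group. -/

/-- An MV-chain with `0 ≠ 1`. -/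
class IsMVChain (C : Type u) [MVAlgebra C] : Prop where
  total : ∀ x y : C, x ≤ₘ y ∨ y ≤ₘ x
  zero_ne_one : (MVAlgebra.zero : C) ≠ MVAlgebra.one C

/-- Chang's group `ℤ × (C ∖ {1})` of an MV-chain `C`, ordered lexicographically. -/
@[ext]
structure ChangGroup (C : Type u) [MVAlgebra C] where
  int : ℤ
  val : C
  val_ne : val ≠ one C

namespace ChangGroup

open Classical in
/-- Addition with carry. -/
def add {C : Type u} [MVAlgebra C] (x y : ChangGroup C) : ChangGroup C :=
  if h : x.val ⊕ₘ y.val = one C then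
    ⟨x.int + y.int + 1, x.val ⊙ₘ y.val,
      fun h' => x.val_ne (one_le (h' ▸ odot_le_left x.val y.val))⟩
  else ⟨x.int + y.int, x.val ⊕ₘ y.val, h⟩

variable {C : Type u} [MVAlgebra C]

theorem add_of_carry {x y : ChangGroup C} (h : x.val ⊕ₘ y.val = one C) :
    (add x y).int = x.int + y.int + 1 ∧ (add x y).val = x.val ⊙ₘ y.val := by
  rw [add, dif_pos h]; exact ⟨rfl, rfl⟩

theorem add_of_not_carry {x y : ChangGroup C} (h : x.val ⊕ₘ y.val ≠ one C) :
    (add x y).int = x.int + y.int ∧ (add x y).val = x.val ⊕ₘ y.val := by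
  rw [add, dif_neg h]; exact ⟨rfl, rfl⟩

protected theorem add_comm (x y : ChangGroup C) : add x y = add y x := by
  by_cases h : x.val ⊕ₘ y.val = one C
  · obtain ⟨i1, v1⟩ := add_of_carry h
    obtain ⟨i2, v2⟩ := add_of_carry (x := y) (y := x) (by rwa [oplus_comm])
    exact ChangGroup.ext (by omega) (by rw [v1, v2, odot_comm])
  · obtain ⟨i1, v1⟩ := add_of_not_carry h
    obtain ⟨i2, v2⟩ := add_of_not_carry (x := y) (y := x) (by rwa [oplus_comm])
    exact ChangGroup.ext (by omega) (by rw [v1, v2, oplus_comm])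

theorem assoc_low {a b c : C} (hab : a ≤ₘ ∼b) (hbc : c ≤ₘ ∼b) :
    (a ⊕ₘ b) ⊙ₘ c = a ⊙ₘ (b ⊕ₘ c) := by
  have e1 : (a ⊕ₘ b) ⊙ₘ c = c ⊖ₘ (∼b ⊖ₘ a) := by
    rw [odot_comm, ominus, ominus_eq, MVAlgebra.neg_neg, MVAlgebra.neg_neg, oplus_comm]
  have e2 : a ⊙ₘ (b ⊕ₘ c) = a ⊖ₘ (∼b ⊖ₘ c) := by
    rw [ominus, ominus_eq, MVAlgebra.neg_neg, MVAlgebra.neg_neg]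
  rw [e1, e2]
  conv => lhs; lhs; rw [← ominus_ominus_self hbc]
  conv => rhs; lhs; rw [← ominus_ominus_self hab]
  rw [ominus_ominus, ominus_ominus, oplus_comm]

theorem assoc_high {a b c : C} (hab : ∼a ≤ₘ b) (hbc : ∼c ≤ₘ b) :
    a ⊙ₘ b ⊕ₘ c = a ⊕ₘ b ⊙ₘ c := by
  apply MVAlgebra.neg_inj
  rw [neg_oplus, neg_oplus, neg_odot, neg_odot]
  apply assoc_low <;> rwa [MVAlgebra.neg_neg]

theorem assoc_mid {a b c : C} (hab : a ≤ₘ ∼b) (hbc : ∼b ≤ₘ c) :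
    (a ⊕ₘ b) ⊙ₘ c = a ⊕ₘ b ⊙ₘ c := by
  have e1 : (a ⊕ₘ b) ⊙ₘ c = c ⊖ₘ (∼b ⊖ₘ a) := by
    rw [odot_comm, ominus, ominus_eq, MVAlgebra.neg_neg, MVAlgebra.neg_neg, oplus_comm]
  have e2 : b ⊙ₘ c = c ⊖ₘ ∼b := by rw [ominus, MVAlgebra.neg_neg, odot_comm]
  rw [e1, e2]
  set w := ∼b ⊖ₘ a with hw
  have hwc : w ≤ₘ c := le_trans (ominus_le _ _) hbc
  have h1 : c ⊖ₘ w ≤ₘ ∼w := by rw [ominus, odot_comm]; exact odot_le_left _ _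
  have h2 : a ⊕ₘ (c ⊖ₘ ∼b) ≤ₘ ∼w := by
    rw [hw, ominus_eq (∼b), MVAlgebra.neg_neg, MVAlgebra.neg_neg, oplus_comm]
    refine oplus_le_oplus_right ?_ a
    rw [ominus, MVAlgebra.neg_neg, odot_comm]; exact odot_le_left _ _
  rw [← oplus_ominus h1, ← oplus_ominus h2, ominus_oplus hwc]
  congr 1
  have : a ⊕ₘ (c ⊖ₘ ∼b) ⊕ₘ w = c ⊖ₘ ∼b ⊕ₘ (w ⊕ₘ a) := by ac_rfl
  rw [this, hw, ominus_oplus hab, ominus_oplus hbc]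

/-- The lexicographic order. -/
instance : LE (ChangGroup C) := ⟨fun x y => x.int < y.int ∨ x.int = y.int ∧ x.val ≤ₘ y.val⟩

theorem le_def (x y : ChangGroup C) :
    x ≤ y ↔ x.int < y.int ∨ x.int = y.int ∧ x.val ≤ₘ y.val := Iff.rfl

instance : Add (ChangGroup C) := ⟨add⟩

theorem add_def (x y : ChangGroup C) : x + y = add x y := rfl

theorem add_le_add_right' {x y : ChangGroup C} (h : x ≤ y) (z : ChangGroup C) :
    x + z ≤ y + z := by
  rw [le_def] at h ⊢
  simp only [add_def]
  by_cases c1 : x.val ⊕ₘ z.val = one C <;> by_cases c2 : y.val ⊕ₘ z.val = one C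
  · obtain ⟨i1, v1⟩ := add_of_carry c1
    obtain ⟨i2, v2⟩ := add_of_carry c2
    rw [i1, i2, v1, v2]
    rcases h with h | ⟨h, h'⟩
    · left; omega
    · right; exact ⟨by omega, odot_le_odot h' (MVAlgebra.le_refl _)⟩
  · obtain ⟨i1, v1⟩ := add_of_carry c1
    obtain ⟨i2, v2⟩ := add_of_not_carry c2
    rw [i1, i2, v1, v2]
    rcases h with h | ⟨h, h'⟩
    · rcases (Int.add_one_le_iff.2 h).lt_or_eq with k | k
      · left; omega
      · right
        refine ⟨by omega, MVAlgebra.le_trans (y := z.val) ?_ ?_⟩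
        · rw [odot_comm]; exact odot_le_left _ _
        · rw [oplus_comm]; exact le_oplus_left _ _
    · exact absurd (one_le (c1 ▸ oplus_le_oplus_right h' z.val)) c2
  · obtain ⟨i1, v1⟩ := add_of_not_carry c1
    obtain ⟨i2, v2⟩ := add_of_carry c2
    rw [i1, i2]
    left
    rcases h with h | ⟨h, h'⟩ <;> omega
  · obtain ⟨i1, v1⟩ := add_of_not_carry c1
    obtain ⟨i2, v2⟩ := add_of_not_carry c2
    rw [i1, i2, v1, v2]
    rcases h with h | ⟨h, h'⟩
    · left; omega
    · right; exact ⟨by omega, oplus_le_oplus_right h' _⟩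

variable [IsMVChain C]

theorem le_neg_of_ne {a b : C} (h : a ⊕ₘ b ≠ one C) : a ≤ₘ ∼b := by
  rcases IsMVChain.total a (∼b) with h' | h'
  · exact h'
  · exact absurd (by rw [oplus_comm]; exact oplus_eq_one_iff.2 h') h

protected theorem add_assoc (x y z : ChangGroup C) : add (add x y) z = add x (add y z) := by
  obtain ⟨m, a, ha⟩ := x
  obtain ⟨n, b, hb⟩ := y
  obtain ⟨k, c, hc⟩ := z
  have key : ∀ (u v : ChangGroup C), u.int = v.int → u.val = v.val → u = v :=
    fun u v h h' => ChangGroup.ext h h'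
  -- the middle case, used twice
  have mid : ∀ (m n k : ℤ) (a b c : C) (ha : a ≠ one C) (hb : b ≠ one C) (hc : c ≠ one C),
      a ⊕ₘ b ≠ one C → b ⊕ₘ c = one C →
      add (add ⟨m, a, ha⟩ ⟨n, b, hb⟩) ⟨k, c, hc⟩ = add ⟨m, a, ha⟩ (add ⟨n, b, hb⟩ ⟨k, c, hc⟩) := by
    intro m n k a b c ha hb hc h1 h2
    obtain ⟨i1, v1⟩ := add_of_not_carry (x := ⟨m, a, ha⟩) (y := ⟨n, b, hb⟩) h1
    obtain ⟨i2, v2⟩ := add_of_carry (x := ⟨n, b, hb⟩) (y := ⟨k, c, hc⟩) h2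
    generalize add (⟨m, a, ha⟩ : ChangGroup C) ⟨n, b, hb⟩ = p at *
    generalize add (⟨n, b, hb⟩ : ChangGroup C) ⟨k, c, hc⟩ = q at *
    simp only at i1 v1 i2 v2
    have e := assoc_mid (le_neg_of_ne h1) (oplus_eq_one_iff.1 h2)
    have c1 : p.val ⊕ₘ c = one C := by rw [v1, oplus_assoc, h2, oplus_one]
    have c2 : a ⊕ₘ q.val ≠ one C := by
      rw [v2, ← e]
      intro h
      apply hc
      refine one_le ?_
      rw [← h, odot_comm]; exact odot_le_left _ _
    obtain ⟨i3, v3⟩ := add_of_carry (x := p) (y := ⟨k, c, hc⟩) c1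
    obtain ⟨i4, v4⟩ := add_of_not_carry (x := ⟨m, a, ha⟩) (y := q) c2
    apply key
    · rw [i3, i4, i1, i2]; simp only; ring
    · rw [v3, v4, v1, v2]; exact e
  by_cases h1 : a ⊕ₘ b = one C <;> by_cases h2 : b ⊕ₘ c = one C
  · obtain ⟨i1, v1⟩ := add_of_carry (x := ⟨m, a, ha⟩) (y := ⟨n, b, hb⟩) h1
    obtain ⟨i2, v2⟩ := add_of_carry (x := ⟨n, b, hb⟩) (y := ⟨k, c, hc⟩) h2
    generalize add (⟨m, a, ha⟩ : ChangGroup C) ⟨n, b, hb⟩ = p at *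
    generalize add (⟨n, b, hb⟩ : ChangGroup C) ⟨k, c, hc⟩ = q at *
    simp only at i1 v1 i2 v2
    have e := assoc_high (oplus_eq_one_iff.1 h1)
      (oplus_eq_one_iff.1 (by rw [oplus_comm]; exact h2))
    have e' : p.val ⊕ₘ c = a ⊕ₘ q.val := by rw [v1, v2, e]
    by_cases h : p.val ⊕ₘ c = one C
    · obtain ⟨i3, v3⟩ := add_of_carry (x := p) (y := ⟨k, c, hc⟩) h
      obtain ⟨i4, v4⟩ := add_of_carry (x := ⟨m, a, ha⟩) (y := q) (e' ▸ h)
      apply key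
      · rw [i3, i4, i1, i2]; simp only; ring
      · rw [v3, v4, v1, v2]; exact odot_assoc _ _ _
    · obtain ⟨i3, v3⟩ := add_of_not_carry (x := p) (y := ⟨k, c, hc⟩) h
      obtain ⟨i4, v4⟩ := add_of_not_carry (x := ⟨m, a, ha⟩) (y := q) (e' ▸ h)
      apply key
      · rw [i3, i4, i1, i2]; simp only; ring
      · rw [v3, v4]; exact e'
  · have := mid k n m c b a hc hb ha (by rwa [oplus_comm]) (by rwa [oplus_comm])
    rw [ChangGroup.add_comm _ ⟨k, c, hc⟩, ChangGroup.add_comm ⟨m, a, ha⟩ ⟨n, b, hb⟩, ← this,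
      ChangGroup.add_comm _ ⟨m, a, ha⟩, ChangGroup.add_comm ⟨k, c, hc⟩ ⟨n, b, hb⟩]
  · exact mid m n k a b c ha hb hc h1 h2
  · obtain ⟨i1, v1⟩ := add_of_not_carry (x := ⟨m, a, ha⟩) (y := ⟨n, b, hb⟩) h1
    obtain ⟨i2, v2⟩ := add_of_not_carry (x := ⟨n, b, hb⟩) (y := ⟨k, c, hc⟩) h2
    generalize add (⟨m, a, ha⟩ : ChangGroup C) ⟨n, b, hb⟩ = p at *
    generalize add (⟨n, b, hb⟩ : ChangGroup C) ⟨k, c, hc⟩ = q at *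
    simp only at i1 v1 i2 v2
    have e := assoc_low (le_neg_of_ne h1) (le_neg_of_ne (by rw [oplus_comm]; exact h2))
    have e' : p.val ⊕ₘ c = a ⊕ₘ q.val := by rw [v1, v2, oplus_assoc]
    by_cases h : p.val ⊕ₘ c = one C
    · obtain ⟨i3, v3⟩ := add_of_carry (x := p) (y := ⟨k, c, hc⟩) h
      obtain ⟨i4, v4⟩ := add_of_carry (x := ⟨m, a, ha⟩) (y := q) (e' ▸ h)
      apply key
      · rw [i3, i4, i1, i2]; simp only; ring
      · rw [v3, v4, v1, v2]; exact e
    · obtain ⟨i3, v3⟩ := add_of_not_carry (x := p) (y := ⟨k, c, hc⟩) h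
      obtain ⟨i4, v4⟩ := add_of_not_carry (x := ⟨m, a, ha⟩) (y := q) (e' ▸ h)
      apply key
      · rw [i3, i4, i1, i2]; simp only; ring
      · rw [v3, v4]; exact e'

/-- The integer `n` in the group. -/
def ofInt (n : ℤ) : ChangGroup C := ⟨n, zero, IsMVChain.zero_ne_one⟩

theorem ofInt_add (n : ℤ) (x : ChangGroup C) : add (ofInt n) x = ⟨n + x.int, x.val, x.val_ne⟩ := by
  have h : (ofInt n : ChangGroup C).val ⊕ₘ x.val ≠ one C := by
    rw [ofInt, zero_oplus]; exact x.val_ne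
  obtain ⟨i, v⟩ := add_of_not_carry h
  exact ChangGroup.ext i (by rw [v, ofInt, zero_oplus])

open Classical in
/-- Negation. -/
def negate (x : ChangGroup C) : ChangGroup C :=
  if h : x.val = zero then ofInt (-x.int)
  else ⟨-x.int - 1, ∼x.val, fun h' => h (by rw [← MVAlgebra.neg_neg x.val, h', neg_one])⟩

theorem negate_add (x : ChangGroup C) : add (negate x) x = ofInt 0 := by
  unfold negate
  split_ifs with h
  · rw [ofInt_add]; exact ChangGroup.ext (by simp [ofInt]) h
  · obtain ⟨i, v⟩ := add_of_carry (x := ⟨-x.int - 1, ∼x.val, fun h' =>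
      h (by rw [← MVAlgebra.neg_neg x.val, h', neg_one])⟩) (y := x) (neg_oplus_self x.val)
    exact ChangGroup.ext (by rw [i]; simp only [ofInt]; ring)
      (by rw [v, odot_comm]; exact odot_neg_self _)

instance : Zero (ChangGroup C) := ⟨ofInt 0⟩
instance : Neg (ChangGroup C) := ⟨negate⟩

instance : AddCommGroup (ChangGroup C) where
  add_assoc := ChangGroup.add_assoc
  add_comm := ChangGroup.add_comm
  zero_add x := (ofInt_add 0 x).trans (ChangGroup.ext (zero_add _) rfl)
  add_zero x := (ChangGroup.add_comm x (ofInt 0)).trans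
    ((ofInt_add 0 x).trans (ChangGroup.ext (zero_add _) rfl))
  nsmul := nsmulRec
  zsmul := zsmulRec
  neg_add_cancel := negate_add

instance : LinearOrder (ChangGroup C) where
  le_refl x := Or.inr ⟨rfl, MVAlgebra.le_refl _⟩
  le_trans x y z := by
    rintro (h | ⟨h, h'⟩) (k | ⟨k, k'⟩)
    · exact Or.inl (h.trans k)
    · exact Or.inl (k ▸ h)
    · exact Or.inl (h ▸ k)
    · exact Or.inr ⟨h.trans k, MVAlgebra.le_trans h' k'⟩
  le_antisymm x y := by
    rintro (h | ⟨h, h'⟩) (k | ⟨k, k'⟩)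
    · omega
    · omega
    · omega
    · exact ChangGroup.ext h (MVAlgebra.le_antisymm h' k')
  le_total x y := by
    rcases lt_trichotomy x.int y.int with h | h | h
    · exact Or.inl (Or.inl h)
    · rcases IsMVChain.total x.val y.val with k | k
      · exact Or.inl (Or.inr ⟨h, k⟩)
      · exact Or.inr (Or.inr ⟨h.symm, k⟩)
    · exact Or.inr (Or.inl h)
  toDecidableLE := Classical.decRel _

instance : IsOrderedAddMonoid (ChangGroup C) where
  add_le_add_left _ _ h z := add_le_add_right' h z

theorem nsmul_digit (b : C) (hb : b ≠ one C) (n : ℕ) :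
    (mul n b ≠ one C ∧ (n • (⟨0, b, hb⟩ : ChangGroup C)).int = 0 ∧
      (n • (⟨0, b, hb⟩ : ChangGroup C)).val = mul n b) ∨
    ofInt 1 ≤ n • (⟨0, b, hb⟩ : ChangGroup C) := by
  induction n with
  | zero => exact Or.inl ⟨IsMVChain.zero_ne_one, by rw [zero_nsmul]; exact ⟨rfl, rfl⟩⟩
  | succ n ih =>
    rw [succ_nsmul]
    rcases ih with ⟨h1, h2, h3⟩ | h
    · by_cases c : (n • (⟨0, b, hb⟩ : ChangGroup C)).val ⊕ₘ b = one C
      · obtain ⟨i, v⟩ := add_of_carry (y := ⟨0, b, hb⟩) c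
        right
        rw [add_def, le_def, i, v, h2]
        exact Or.inr ⟨rfl, zero_le _⟩
      · obtain ⟨i, v⟩ := add_of_not_carry (y := ⟨0, b, hb⟩) c
        left
        rw [add_def, i, v, h2, mul, ← h3]
        exact ⟨c, rfl, rfl⟩
    · right
      refine h.trans ?_
      have : (0 : ChangGroup C) ≤ ⟨0, b, hb⟩ := Or.inr ⟨rfl, zero_le _⟩
      exact le_add_of_nonneg_right this

theorem nsmul_ofInt (n : ℕ) : n • (ofInt 1 : ChangGroup C) = ofInt n := by
  induction n with
  | zero => rw [zero_nsmul]; rfl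
  | succ n ih =>
    rw [succ_nsmul, ih, add_def, ofInt_add]
    exact ChangGroup.ext (by simp [ofInt]) rfl

theorem archimedean (h : ∀ b : C, b ≠ zero → ∃ n, mul n b = one C) :
    Archimedean (ChangGroup C) := by
  have h1 : ∀ x : ChangGroup C, ∃ n : ℕ, x ≤ n • ofInt 1 := by
    intro x
    refine ⟨(x.int + 1).toNat, ?_⟩
    rw [nsmul_ofInt, le_def]
    left
    simp only [ofInt]
    have := Int.self_le_toNat (x.int + 1)
    omega
  have h2 : ∀ y : ChangGroup C, 0 < y → ∃ n : ℕ, ofInt 1 ≤ n • y := by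
    intro y hy
    obtain ⟨k, b, hb⟩ := y
    have hy' : (0 : ChangGroup C) ≤ ⟨k, b, hb⟩ := hy.le
    rcases hy' with h' | ⟨h', -⟩
    · refine ⟨1, ?_⟩
      rw [one_nsmul, le_def]
      have h'' : (0 : ℤ) < k := h'
      rcases (Int.add_one_le_iff.2 h'').lt_or_eq with h3 | h3
      · left; simpa [ofInt] using h3
      · right; exact ⟨by simpa [ofInt] using h3, zero_le _⟩
    · have h'' : (0 : ℤ) = k := h'
      subst h''
      obtain ⟨n, hn⟩ := h b (by rintro rfl; exact lt_irrefl _ hy)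
      rcases nsmul_digit b hb n with ⟨h3, -⟩ | h3
      · exact absurd hn h3
      · exact ⟨n, h3⟩
  refine ⟨fun x y hy => ?_⟩
  obtain ⟨n, hn⟩ := h1 x
  obtain ⟨m, hm⟩ := h2 y hy
  refine ⟨m * n, hn.trans ?_⟩
  rw [mul_comm, mul_nsmul']
  exact nsmul_le_nsmul_right hm n

open Classical in
/-- The embedding of the chain as the interval from `0` to `ofInt 1`. -/
def embed (a : C) : ChangGroup C := if h : a = one C then ofInt 1 else ⟨0, a, h⟩

theorem embed_one : embed (one C) = ofInt 1 := dif_pos rfl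
theorem embed_of_ne {a : C} (h : a ≠ one C) : embed a = ⟨0, a, h⟩ := dif_neg h
theorem embed_zero : embed (MVAlgebra.zero : C) = 0 := embed_of_ne IsMVChain.zero_ne_one

theorem embed_nonneg (a : C) : 0 ≤ embed a := by
  by_cases h : a = one C
  · subst h; rw [embed_one]; exact Or.inl (by change (0 : ℤ) < 1; norm_num)
  · rw [embed_of_ne h]; exact Or.inr ⟨rfl, zero_le _⟩

theorem embed_add_of_carry {a b : C} (h : a ⊕ₘ b = one C) :
    embed a + embed b = ofInt 1 + embed (a ⊙ₘ b) := by
  by_cases ha : a = one C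
  · subst ha; rw [embed_one, odot_comm, odot_one]
  by_cases hb : b = one C
  · subst hb; rw [embed_one, odot_one, _root_.add_comm]
  have hab : a ⊙ₘ b ≠ one C := fun h' => ha (one_le (h' ▸ odot_le_left a b))
  rw [embed_of_ne ha, embed_of_ne hb, embed_of_ne hab, add_def, add_def, ofInt_add]
  obtain ⟨i, v⟩ := add_of_carry (x := ⟨0, a, ha⟩) (y := ⟨0, b, hb⟩) h
  exact ChangGroup.ext (by rw [i]; rfl) v

theorem embed_add_of_not_carry {a b : C} (h : a ⊕ₘ b ≠ one C) :
    embed a + embed b = embed (a ⊕ₘ b) := by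
  have ha : a ≠ one C := by rintro rfl; exact h (one_oplus _)
  have hb : b ≠ one C := by rintro rfl; exact h (oplus_one _)
  rw [embed_of_ne ha, embed_of_ne hb, embed_of_ne h, add_def]
  obtain ⟨i, v⟩ := add_of_not_carry (x := ⟨0, a, ha⟩) (y := ⟨0, b, hb⟩) h
  exact ChangGroup.ext (by rw [i]; rfl) v

end ChangGroup

/-- A chain all of whose nonzero elements have a multiple equal to `1` embeds into `[0, 1]`. -/
theorem IsMVChain.exists_embedding {C : Type u} [MVAlgebra C] [IsMVChain C]
    (h : ∀ b : C, b ≠ MVAlgebra.zero → ∃ n, mul n b = one C) :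
    ∃ φ : MVHom C unitInterval, Function.Injective φ.toFun := by
  have := ChangGroup.archimedean h
  obtain ⟨f, hf⟩ := Archimedean.exists_orderAddMonoidHom_real_injective (ChangGroup C)
  set e : C → ChangGroup C := ChangGroup.embed with he
  have h01 : (0 : ChangGroup C) < ChangGroup.ofInt 1 :=
    lt_of_le_of_ne (Or.inl (by change (0 : ℤ) < 1; norm_num))
      (fun h' => Int.zero_ne_one (congrArg ChangGroup.int h'))
  have hu : 0 < f (ChangGroup.ofInt 1) := by
    refine lt_of_le_of_ne ?_ ?_
    · have := f.monotone' h01.le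
      simpa using this
    · intro h'
      exact h01.ne (hf (by rw [map_zero]; exact h'))
  set g : C → ℝ := fun a => f (e a) / f (ChangGroup.ofInt 1) with hg
  have g0 : ∀ a, 0 ≤ g a := fun a => by
    have := f.monotone' (ChangGroup.embed_nonneg a)
    have h2 : 0 ≤ f (e a) := by simpa using this
    exact div_nonneg h2 hu.le
  have gzero : g MVAlgebra.zero = 0 := by simp only [hg, he, ChangGroup.embed_zero, map_zero, zero_div]
  have gone : g (one C) = 1 := by
    simp only [hg, he, ChangGroup.embed_one]; exact div_self hu.ne'
  have gcarry : ∀ a b, a ⊕ₘ b = one C → g a + g b = 1 + g (a ⊙ₘ b) := fun a b hab => by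
    simp only [hg, ← add_div, ← map_add, he, ChangGroup.embed_add_of_carry hab]
    rw [map_add, add_div, div_self hu.ne']
  have gnot : ∀ a b, a ⊕ₘ b ≠ one C → g a + g b = g (a ⊕ₘ b) := fun a b hab => by
    simp only [hg, ← add_div, ← map_add, he, ChangGroup.embed_add_of_not_carry hab]
  have gneg : ∀ a, g ∼a = 1 - g a := fun a => by
    have := gcarry a ∼a (oplus_neg_self a)
    rw [odot_neg_self, gzero] at this
    linarith
  have g1 : ∀ a, g a ≤ 1 := fun a => by linarith [gneg a, g0 ∼a]
  refine ⟨⟨fun a => ⟨g a, g0 a, g1 a⟩, Subtype.ext gzero, fun a => Subtype.ext (gneg a),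
    fun a b => Subtype.ext ?_⟩, ?_⟩
  · rw [unitInterval.coe_oplus]
    by_cases hab : a ⊕ₘ b = one C
    · rw [min_eq_left]
      · simp only [hab, gone]
      · have := gcarry a b hab
        have := g0 (a ⊙ₘ b)
        simp only; linarith
    · have h1 := gnot a b hab
      have := g1 (a ⊕ₘ b)
      simp only [h1]
      rw [min_eq_right this]
  · intro a b hab
    have h1 : g a = g b := congrArg Subtype.val hab
    have h2 : f (e a) = f (e b) := by
      have := congrArg (· * f (ChangGroup.ofInt 1)) h1
      simpa only [hg, div_mul_cancel₀ _ hu.ne'] using this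
    have h3 : e a = e b := hf h2
    by_cases ha : a = one C <;> by_cases hb : b = one C
    · rw [ha, hb]
    · simp only [he] at h3
      rw [ha, ChangGroup.embed_one, ChangGroup.embed_of_ne hb] at h3
      exact absurd (congrArg ChangGroup.int h3) _root_.one_ne_zero
    · simp only [he] at h3
      rw [hb, ChangGroup.embed_one, ChangGroup.embed_of_ne ha] at h3
      exact absurd (congrArg ChangGroup.int h3) _root_.zero_ne_one
    · simp only [he] at h3
      rw [ChangGroup.embed_of_ne ha, ChangGroup.embed_of_ne hb] at h3
      exact congrArg ChangGroup.val h3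

namespace MVIdeal

variable {A : Type u} [MVAlgebra A]

/-- The congruence of an ideal: `x ~ y` iff `d(x, y) ∈ I`, i.e. iff `x ⊖ y, y ⊖ x ∈ I`. -/
def setoid (I : MVIdeal A) : Setoid A where
  r x y := x ⊖ₘ y ∈ I.carrier ∧ y ⊖ₘ x ∈ I.carrier
  iseqv :=
    { refl := fun x => by rw [ominus_self]; exact ⟨I.zero_mem, I.zero_mem⟩
      symm := fun h => ⟨h.2, h.1⟩
      trans := by
        have key : ∀ x y z : A, x ⊖ₘ y ∈ I.carrier → y ⊖ₘ z ∈ I.carrier → x ⊖ₘ z ∈ I.carrier := by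
          intro x y z h h'
          refine I.lower _ _ ?_ (I.oplus_mem _ h' _ h)
          rw [ominus_le_iff, ← oplus_assoc]
          refine MVAlgebra.le_trans (ominus_le_iff.1 (MVAlgebra.le_refl (x ⊖ₘ y))) ?_
          exact oplus_le_oplus_right (ominus_le_iff.1 (MVAlgebra.le_refl _)) _
        exact fun {_ _ _} h h' => ⟨key _ _ _ h.1 h'.1, key _ _ _ h'.2 h.2⟩ }

/-- The quotient algebra `A / I`. -/
def Quotient (I : MVIdeal A) : Type u := _root_.Quotient I.setoid

/-- The projection `a ↦ a / I`. -/
def toQuotient (I : MVIdeal A) (a : A) : I.Quotient := _root_.Quotient.mk I.setoid a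

theorem oplus_ominus_oplus_mem (I : MVIdeal A) {x x' y y' : A} (h : x ⊖ₘ x' ∈ I.carrier)
    (h' : y ⊖ₘ y' ∈ I.carrier) : x ⊕ₘ y ⊖ₘ (x' ⊕ₘ y') ∈ I.carrier := by
  refine I.lower _ _ ?_ (I.oplus_mem _ h _ h')
  rw [ominus_le_iff]
  have := oplus_le_oplus (ominus_le_iff.1 (MVAlgebra.le_refl (x ⊖ₘ x')))
    (ominus_le_iff.1 (MVAlgebra.le_refl (y ⊖ₘ y')))
  have e : x' ⊕ₘ (x ⊖ₘ x') ⊕ₘ (y' ⊕ₘ (y ⊖ₘ y')) = x' ⊕ₘ y' ⊕ₘ (x ⊖ₘ x' ⊕ₘ (y ⊖ₘ y')) := by ac_rfl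
  rwa [e] at this

theorem neg_ominus_neg (x y : A) : ∼x ⊖ₘ ∼y = y ⊖ₘ x := by
  rw [ominus, MVAlgebra.neg_neg, odot_comm, ominus]

instance (I : MVIdeal A) : MVAlgebra I.Quotient where
  oplus := _root_.Quotient.map₂ (· ⊕ₘ ·) fun _ _ h _ _ h' =>
    ⟨I.oplus_ominus_oplus_mem h.1 h'.1, I.oplus_ominus_oplus_mem h.2 h'.2⟩
  neg := _root_.Quotient.map (∼·) fun a b h => by
    change ∼a ⊖ₘ ∼b ∈ I.carrier ∧ ∼b ⊖ₘ ∼a ∈ I.carrier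
    rw [neg_ominus_neg, neg_ominus_neg]; exact ⟨h.2, h.1⟩
  zero := I.toQuotient zero
  oplus_assoc := by
    rintro ⟨x⟩ ⟨y⟩ ⟨z⟩; exact congrArg I.toQuotient (oplus_assoc x y z)
  oplus_comm := by rintro ⟨x⟩ ⟨y⟩; exact congrArg I.toQuotient (oplus_comm x y)
  oplus_zero := by rintro ⟨x⟩; exact congrArg I.toQuotient (oplus_zero x)
  neg_neg := by rintro ⟨x⟩; exact congrArg I.toQuotient (MVAlgebra.neg_neg x)
  oplus_neg_zero := by rintro ⟨x⟩; exact congrArg I.toQuotient (oplus_neg_zero x)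
  luk := by rintro ⟨x⟩ ⟨y⟩; exact congrArg I.toQuotient (luk x y)

/-- The canonical projection `π_I : A → A / I`. -/
def proj (I : MVIdeal A) : MVHom A I.Quotient := ⟨I.toQuotient, rfl, fun _ => rfl, fun _ _ => rfl⟩

theorem proj_surjective (I : MVIdeal A) : Function.Surjective I.proj.toFun := by
  rintro ⟨x⟩; exact ⟨x, rfl⟩

theorem proj_eq_iff (I : MVIdeal A) (x y : A) :
    I.proj x = I.proj y ↔ x ⊖ₘ y ∈ I.carrier ∧ y ⊖ₘ x ∈ I.carrier :=
  @_root_.Quotient.eq A I.setoid x y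

theorem proj_eq_zero_iff (I : MVIdeal A) (x : A) : I.proj x = zero ↔ x ∈ I.carrier := by
  rw [← I.proj.map_zero', proj_eq_iff]
  have : x ⊖ₘ zero = x := by rw [ominus, MVAlgebra.neg_zero, odot_one]
  rw [this, zero_ominus]
  exact ⟨fun h => h.1, fun h => ⟨h, I.zero_mem⟩⟩

theorem IsMaximal.exists_mul_quotient {M : MVIdeal A} (hM : M.IsMaximal) (b : M.Quotient)
    (hb : b ≠ zero) : ∃ n, mul n b = one M.Quotient := by
  obtain ⟨a, rfl⟩ := M.proj_surjective b
  obtain ⟨n, hn⟩ := hM.exists_mul (a := a) fun h => hb ((M.proj_eq_zero_iff a).2 h)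
  refine ⟨n, ?_⟩
  rw [← M.proj_eq_zero_iff, MVHom.map_neg', MVHom.map_mul] at hn
  rw [← MVAlgebra.neg_neg (mul n _), hn, MVAlgebra.neg_zero]

theorem IsMaximal.isMVChain {M : MVIdeal A} (hM : M.IsMaximal) : IsMVChain M.Quotient where
  total x y := by
    by_contra h
    push Not at h
    rw [← ominus_eq_zero_iff, ← ominus_eq_zero_iff] at h
    obtain ⟨n, hn⟩ := hM.exists_mul_quotient _ h.2
    refine h.1 (disjoint_mul (fun t h1 h2 => prelinear h1 h2) n _ (MVAlgebra.le_refl _) ?_)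
    rw [hn]; exact le_one _
  zero_ne_one h := by
    have h1 := (isProper_iff M).1 hM.1
    rw [← proj_eq_zero_iff, MVHom.map_one] at h1
    exact h1 h.symm

end MVIdeal

theorem unitInterval.exists_mul_eq_one {t : unitInterval} (ht : t ≠ MVAlgebra.zero) :
    ∃ n, mul n t = one unitInterval := by
  have hpos : 0 < (t : ℝ) := lt_of_le_of_ne t.2.1 fun h => ht (Subtype.ext h.symm)
  have key : ∀ n : ℕ, ((mul n t : unitInterval) : ℝ) = min 1 (n * (t : ℝ)) := by
    intro n
    induction n with
    | zero => rw [mul, unitInterval.coe_mvzero]; simp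
    | succ n ih => rw [mul, unitInterval.coe_oplus, ih]; push_cast; grind
  obtain ⟨n, hn⟩ := exists_nat_ge (1 / (t : ℝ))
  refine ⟨n, Subtype.ext ?_⟩
  rw [key, unitInterval.coe_mvone, min_eq_left]
  rwa [div_le_iff₀ hpos] at hn

/-- A homomorphism to `[0, 1]` is determined by its kernel. -/
theorem MVHom.eq_of_ker_eq {A : Type u} [MVAlgebra A] {φ ψ : MVHom A unitInterval}
    (h : ∀ a, φ a = MVAlgebra.zero ↔ ψ a = MVAlgebra.zero) : φ = ψ := by
  have key : ∀ (φ ψ : MVHom A unitInterval),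
      (∀ a, φ a = MVAlgebra.zero ↔ ψ a = MVAlgebra.zero) →
      ∀ (n : ℕ) (a : A), ¬ (1 / 2 ^ n : ℝ) ≤ (ψ a : ℝ) - φ a := by
    intro φ ψ h n
    induction n with
    | zero =>
      intro a ha
      have h1 := (φ a).2.1; have h2 := (ψ a).2.2
      have h3 : φ a = MVAlgebra.zero := Subtype.ext (by
        rw [unitInterval.coe_mvzero]; norm_num at ha; linarith)
      have h4 := congrArg Subtype.val ((h a).1 h3)
      rw [h3, h4, unitInterval.coe_mvzero] at ha
      norm_num at ha
    | succ n ih =>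
      intro a ha
      have hp : (0 : ℝ) < 1 / 2 ^ n := by positivity
      have he : (1 / 2 ^ (n + 1) : ℝ) = (1 / 2 ^ n) / 2 := by rw [pow_succ]; field_simp
      rw [he] at ha
      by_cases c1 : (ψ a : ℝ) ≤ 1 / 2
      · apply ih (a ⊕ₘ a)
        rw [φ.map_oplus', ψ.map_oplus', unitInterval.coe_oplus, unitInterval.coe_oplus,
          min_eq_right (by linarith), min_eq_right (by linarith)]
        linarith
      by_cases c2 : 1 / 2 ≤ (φ a : ℝ)
      · apply ih (a ⊙ₘ a)
        rw [φ.map_odot, ψ.map_odot, unitInterval.coe_odot, unitInterval.coe_odot,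
          max_eq_right (by linarith), max_eq_right (by linarith)]
        linarith
      push Not at c1 c2
      have h3 : φ (a ⊙ₘ a) = MVAlgebra.zero := Subtype.ext (by
        rw [φ.map_odot, unitInterval.coe_odot, unitInterval.coe_mvzero, max_eq_left]; linarith)
      have h4 := congrArg Subtype.val ((h _).1 h3)
      rw [ψ.map_odot, unitInterval.coe_odot, unitInterval.coe_mvzero, max_eq_right] at h4 <;>
        linarith
  have le : ∀ (φ ψ : MVHom A unitInterval),
      (∀ a, φ a = MVAlgebra.zero ↔ ψ a = MVAlgebra.zero) → ∀ a, (ψ a : ℝ) ≤ φ a := by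
    intro φ ψ h a
    by_contra hlt
    push Not at hlt
    obtain ⟨n, hn⟩ := exists_pow_lt_of_lt_one (sub_pos.2 hlt) (by norm_num : (1 / 2 : ℝ) < 1)
    apply key φ ψ h n a
    rw [← one_div_pow]; exact hn.le
  refine MVHom.ext (funext fun a => Subtype.ext ?_)
  exact _root_.le_antisymm (le ψ φ (fun a => (h a).symm) a) (le φ ψ h a)

section evaluation

variable {A : Type u} [MVAlgebra A]

/-- For a maximal ideal `M` there is a unique embedding of `A / M` into `[0, 1]`. -/
theorem existsUnique_embedding (M : MaxSpec A) :
    ∃! φ : MVHom M.1.Quotient unitInterval, Function.Injective φ.toFun := by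
  have := M.2.isMVChain
  obtain ⟨φ, hφ⟩ := IsMVChain.exists_embedding M.2.exists_mul_quotient
  refine ⟨φ, hφ, fun ψ hψ => MVHom.eq_of_ker_eq fun a => ?_⟩
  have key : ∀ χ : MVHom M.1.Quotient unitInterval, Function.Injective χ.toFun →
      (χ a = MVAlgebra.zero ↔ a = MVAlgebra.zero) := fun χ hχ =>
    ⟨fun h => hχ (h.trans χ.map_zero'.symm), fun h => by rw [h, χ.map_zero']⟩
  exact (key ψ hψ).trans (key φ hφ).symm

/-- The unique embedding `ι_M : A / M → [0, 1]`. -/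
def MaxSpec.embedding (M : MaxSpec A) : MVHom M.1.Quotient unitInterval :=
  (existsUnique_embedding M).choose

/-- The homomorphism `ι_M ∘ π_M : A → [0, 1]`. -/
def MaxSpec.eval (M : MaxSpec A) : MVHom A unitInterval := M.embedding.comp M.1.proj

theorem MaxSpec.eval_eq_zero_iff (M : MaxSpec A) (a : A) :
    M.eval a = MVAlgebra.zero ↔ a ∈ M.1.carrier := by
  rw [← M.1.proj_eq_zero_iff, ← M.embedding.map_zero']
  exact ⟨fun h => (existsUnique_embedding M).choose_spec.1 h, fun h => congrArg M.embedding h⟩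

/-- The homomorphism `ι : A → [0, 1]^{Max A}`, `a ↦ â`, where `â(M) = ι_M(a / M)`. -/
def hat (A : Type u) [MVAlgebra A] : MVHom A (FuzzySet (MaxSpec A)) where
  toFun a M := M.eval a
  map_zero' := funext fun M => M.eval.map_zero'
  map_neg' x := funext fun M => M.eval.map_neg' x
  map_oplus' x y := funext fun M => M.eval.map_oplus' x y

/-- The kernel of a homomorphism to `[0, 1]` is a maximal ideal. -/
theorem isMaximal_of_ker (φ : MVHom A unitInterval) (I : MVIdeal A)
    (hI : ∀ a, a ∈ I.carrier ↔ φ a = MVAlgebra.zero) : I.IsMaximal := by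
  refine ⟨?_, fun J hJ hIJ => ?_⟩
  · rw [MVIdeal.isProper_iff, hI, φ.map_one]
    intro h
    have := congrArg Subtype.val h
    rw [unitInterval.coe_mvone, unitInterval.coe_mvzero] at this
    exact one_ne_zero this
  · refine MVIdeal.ext (Set.Subset.antisymm (fun a ha => ?_) hIJ)
    by_contra hna
    rw [hI] at hna
    obtain ⟨n, hn⟩ := unitInterval.exists_mul_eq_one hna
    have h1 : ∼(mul n a) ∈ J.carrier := by
      apply hIJ
      rw [hI, φ.map_neg', φ.map_mul, hn, neg_one]
    rw [MVIdeal.isProper_iff] at hJ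
    apply hJ
    rw [← neg_oplus_self (mul n a)]
    exact J.oplus_mem _ h1 _ (J.mul_mem ha n)

variable {B : Type v} [MVAlgebra B]

/-- The preimage of an ideal under a homomorphism. -/
def MVIdeal.comap (h : MVHom A B) (I : MVIdeal B) : MVIdeal A where
  carrier := h.toFun ⁻¹' I.carrier
  zero_mem := by rw [Set.mem_preimage, h.map_zero']; exact I.zero_mem
  oplus_mem x hx y hy := by
    rw [Set.mem_preimage, h.map_oplus']; exact I.oplus_mem _ hx _ hy
  lower x y hxy hy := I.lower _ _ (h.map_le hxy) hy

/-- `Max h : Max B → Max A`, `N ↦ h⁻¹[N]`. -/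
def MaxSpec.comap (h : MVHom A B) (N : MaxSpec B) : MaxSpec A :=
  ⟨N.1.comap h, isMaximal_of_ker (N.eval.comp h) _ fun a => (N.eval_eq_zero_iff (h a)).symm⟩

theorem MaxSpec.eval_comap (h : MVHom A B) (N : MaxSpec B) (a : A) :
    (N.comap h).eval a = N.eval (h a) := by
  have : (N.comap h).eval = N.eval.comp h := MVHom.eq_of_ker_eq fun a =>
    ((N.comap h).eval_eq_zero_iff a).trans (N.eval_eq_zero_iff (h a)).symm
  rw [this]; rfl

end evaluation

/-! ### Semisimple algebras, limit cuts and limit cut complete algebras -/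

/-- Simple MV-algebras: `{0}` is the only proper ideal. -/
def IsSimpleMV (A : Type u) [MVAlgebra A] : Prop :=
  ∀ I : MVIdeal A, I.IsProper ↔ I.carrier = {MVAlgebra.zero}

/-- Semisimple MV-algebras: subdirect products of simple ones. -/
def IsSemisimpleMV (A : Type u) [MVAlgebra A] : Prop :=
  ∃ (X : Type u) (S : X → Type u) (_ : ∀ i, MVAlgebra (S i)) (f : MVHom A (∀ i, S i)),
    (∀ i, IsSimpleMV (S i)) ∧ Function.Injective f.toFun ∧
      ∀ i, Function.Surjective fun a => f a i

section cuts

variable {A : Type u} [MVAlgebra A]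

/-- The set `uZ` of upper bounds of `Z`. -/
def upperSet (Z : Set A) : Set A := {b | ∀ a ∈ Z, a ≤ₘ b}

/-- The set `lZ` of lower bounds of `Z`. -/
def lowerSet (Z : Set A) : Set A := {a | ∀ b ∈ Z, a ≤ₘ b}

/-- `X` is a cut if `X = luX`. -/
def IsCut (X : Set A) : Prop := X = lowerSet (upperSet X)

/-- A cut `X` is a limit cut if `⋀ {d(â, b̂) | b ∈ uX, a ∈ X} = 0` in `[0, 1]^{Max A}`. -/
def IsLimitCut (X : Set A) : Prop :=
  IsCut X ∧
    sInf {α : FuzzySet (MaxSpec A) |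
      ∃ a ∈ X, ∃ b ∈ upperSet X, α = MVAlgebra.dist (hat A a) (hat A b)} = MVAlgebra.zero

end cuts

/-- Limit cut complete (lcc) MV-algebras: semisimple, and every limit cut has a supremum. -/
def IsLccMV (A : Type u) [MVAlgebra A] : Prop :=
  IsSemisimpleMV A ∧
    ∀ X : Set A, IsLimitCut X → ∃ s ∈ upperSet X, ∀ b ∈ upperSet X, s ≤ₘ b

/-- Subalgebras of an MV-algebra. -/
@[ext]
structure MVSubalgebra (A : Type u) [MVAlgebra A] where
  carrier : Set A
  zero_mem : zero ∈ carrier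
  neg_mem : ∀ x ∈ carrier, ∼x ∈ carrier
  oplus_mem : ∀ x ∈ carrier, ∀ y ∈ carrier, x ⊕ₘ y ∈ carrier

namespace MVSubalgebra

variable {A : Type u} [MVAlgebra A]

instance : CoeSort (MVSubalgebra A) (Type u) := ⟨fun B => B.carrier⟩

instance : PartialOrder (MVSubalgebra A) :=
  PartialOrder.lift MVSubalgebra.carrier fun _ _ h => MVSubalgebra.ext h

instance (B : MVSubalgebra A) : MVAlgebra B where
  oplus x y := ⟨x.1 ⊕ₘ y.1, B.oplus_mem _ x.2 _ y.2⟩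
  neg x := ⟨∼x.1, B.neg_mem _ x.2⟩
  zero := ⟨zero, B.zero_mem⟩
  oplus_assoc _ _ _ := Subtype.ext (oplus_assoc _ _ _)
  oplus_comm _ _ := Subtype.ext (oplus_comm _ _)
  oplus_zero _ := Subtype.ext (oplus_zero _)
  neg_neg _ := Subtype.ext (MVAlgebra.neg_neg _)
  oplus_neg_zero _ := Subtype.ext (oplus_neg_zero _)
  luk _ _ := Subtype.ext (luk _ _)

instance : InfSet (MVSubalgebra A) where
  sInf 𝓑 :=
    { carrier := ⋂ B ∈ 𝓑, B.carrier
      zero_mem := Set.mem_iInter₂.2 fun B _ => B.zero_mem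
      neg_mem := fun x hx => Set.mem_iInter₂.2 fun B hB =>
        B.neg_mem x (Set.mem_iInter₂.1 hx B hB)
      oplus_mem := fun x hx y hy => Set.mem_iInter₂.2 fun B hB =>
        B.oplus_mem x (Set.mem_iInter₂.1 hx B hB) y (Set.mem_iInter₂.1 hy B hB) }

end MVSubalgebra

/-- `LCC(A)`: the lcc subalgebras of `[0, 1]^{Max A}` that contain `Â`. -/
def lccSubalgebras (A : Type u) [MVAlgebra A] : Set (MVSubalgebra (FuzzySet (MaxSpec A))) :=
  {B | IsLccMV B ∧ Set.range (hat A).toFun ⊆ B.carrier}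

/-- The limit cut completion `A^lcc = ⋂ LCC(A)`. -/
def limitCutCompletion (A : Type u) [MVAlgebra A] : MVSubalgebra (FuzzySet (MaxSpec A)) :=
  sInf (lccSubalgebras A)

/-! ### MV-topologies -/

/-- MV-topologies on `X`. -/
structure MVTopology (X : Type u) where
  opens : Set (FuzzySet X)
  zero_mem : zero ∈ opens
  one_mem : one _ ∈ opens
  sSup_mem : ∀ S ⊆ opens, sSup S ∈ opens
  odot_mem : ∀ o₁ ∈ opens, ∀ o₂ ∈ opens, o₁ ⊙ₘ o₂ ∈ opens
  oplus_mem : ∀ o₁ ∈ opens, ∀ o₂ ∈ opens, o₁ ⊕ₘ o₂ ∈ opens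
  inf_mem : ∀ o₁ ∈ opens, ∀ o₂ ∈ opens, o₁ ⊓ o₂ ∈ opens

namespace MVTopology

variable {X : Type u}

/-- The closed fuzzy subsets: the complements `o*` of the open ones. -/
def closeds (Ω : MVTopology X) : Set (FuzzySet X) := {c | ∃ o ∈ Ω.opens, c = ∼o}

/-- `Clop τ`, the subalgebra of `[0, 1]^X` of the fuzzy subsets that are open and closed. -/
def clop (Ω : MVTopology X) : MVSubalgebra (FuzzySet X) where
  carrier := Ω.opens ∩ Ω.closeds
  zero_mem := ⟨Ω.zero_mem, one _, Ω.one_mem, neg_one.symm⟩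
  neg_mem := by
    rintro _ ⟨h, o, ho, rfl⟩
    exact ⟨(MVAlgebra.neg_neg o).symm ▸ ho, _, h, rfl⟩
  oplus_mem := by
    rintro _ ⟨h, o, ho, rfl⟩ _ ⟨h', o', ho', rfl⟩
    exact ⟨Ω.oplus_mem _ h _ h', o ⊙ₘ o', Ω.odot_mem _ ho _ ho', (neg_odot _ _).symm⟩

end MVTopology

section maxTopology

variable (A : Type u) [MVAlgebra A]

/-- The joins of families of elements of `Â`. -/
def maxOpens : Set (FuzzySet (MaxSpec A)) :=
  {o | ∃ Γ ⊆ Set.range (hat A).toFun, o = sSup Γ}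

variable {A}

theorem mem_maxOpens_iff {o : FuzzySet (MaxSpec A)} :
    o ∈ maxOpens A ↔ ∀ M, ∀ ε : ℝ, 0 < ε → ∃ a, hat A a ≤ o ∧ (o M : ℝ) - ε ≤ hat A a M := by
  constructor
  · rintro ⟨Γ, hΓ, rfl⟩ M ε hε
    by_cases h0 : (sSup Γ M : ℝ) - ε ≤ 0
    · refine ⟨zero, ?_, ?_⟩
      · rw [(hat A).map_zero']; exact fun N => (sSup Γ N).2.1
      · exact h0.trans (hat A zero M).2.1
    · push Not at h0
      have hlt : (⟨(sSup Γ M : ℝ) - ε, h0.le, by linarith [(sSup Γ M).2.2]⟩ : unitInterval)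
          < sSup Γ M := by
        change (sSup Γ M : ℝ) - ε < sSup Γ M
        linarith
      obtain ⟨⟨γ, hγ⟩, h⟩ := lt_iSup_iff.1 (lt_of_lt_of_eq hlt sSup_apply)
      obtain ⟨a, ha⟩ := hΓ hγ
      refine ⟨a, ha ▸ le_sSup hγ, ?_⟩
      rw [ha]
      have h' : (sSup Γ M : ℝ) - ε < γ M := h
      exact h'.le
  · intro h
    refine ⟨{γ | ∃ a, hat A a = γ ∧ γ ≤ o}, ?_, ?_⟩
    · rintro _ ⟨a, rfl, -⟩; exact ⟨a, rfl⟩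
    · refine _root_.le_antisymm (fun M => ?_) (sSup_le ?_)
      · change (o M : ℝ) ≤ (sSup _ : FuzzySet (MaxSpec A)) M
        refine le_of_forall_pos_le_add fun ε hε => ?_
        obtain ⟨a, ha, ha'⟩ := h M ε hε
        have : hat A a ≤ sSup {γ | ∃ a, hat A a = γ ∧ γ ≤ o} := le_sSup ⟨a, rfl, ha⟩
        have h2 : (hat A a M : ℝ) ≤ (sSup {γ | ∃ a, hat A a = γ ∧ γ ≤ o} : FuzzySet _) M := this M
        linarith
      · rintro _ ⟨a, -, ha⟩; exact ha

theorem hat_mem_maxOpens (a : A) : hat A a ∈ maxOpens A :=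
  mem_maxOpens_iff.2 fun M ε hε => ⟨a, _root_.le_refl _, by linarith⟩

variable (A)

/-- The MV-topology `Ω_A` on `Max A` with base `Â`. -/
def maxTopology : MVTopology (MaxSpec A) where
  opens := maxOpens A
  zero_mem := (hat A).map_zero' ▸ hat_mem_maxOpens zero
  one_mem := (hat A).map_one ▸ hat_mem_maxOpens (one A)
  sSup_mem S hS := by
    refine ⟨{γ | γ ∈ Set.range (hat A).toFun ∧ γ ≤ sSup S}, fun γ h => h.1, ?_⟩
    refine _root_.le_antisymm (sSup_le fun o ho => ?_) (sSup_le fun γ h => h.2)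
    obtain ⟨Γ, hΓ, rfl⟩ := hS ho
    exact sSup_le fun γ hγ => le_sSup ⟨hΓ hγ, (le_sSup hγ).trans (le_sSup ho)⟩
  odot_mem o₁ h₁ o₂ h₂ := by
    rw [mem_maxOpens_iff] at *
    intro M ε hε
    obtain ⟨a, ha, ha'⟩ := h₁ M (ε / 2) (half_pos hε)
    obtain ⟨b, hb, hb'⟩ := h₂ M (ε / 2) (half_pos hε)
    refine ⟨a ⊙ₘ b, fun N => ?_, ?_⟩
    · have h1 : (hat A a N : ℝ) ≤ o₁ N := ha N
      have h2 : (hat A b N : ℝ) ≤ o₂ N := hb N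
      rw [(hat A).map_odot]
      change ((hat A a N ⊙ₘ hat A b N : unitInterval) : ℝ) ≤ (o₁ N ⊙ₘ o₂ N : unitInterval)
      rw [unitInterval.coe_odot, unitInterval.coe_odot]
      exact max_le_max_left _ (by linarith)
    · rw [(hat A).map_odot]
      change ((o₁ M ⊙ₘ o₂ M : unitInterval) : ℝ) - ε ≤ (hat A a M ⊙ₘ hat A b M : unitInterval)
      rw [unitInterval.coe_odot, unitInterval.coe_odot]
      grind
  oplus_mem o₁ h₁ o₂ h₂ := by
    rw [mem_maxOpens_iff] at *
    intro M ε hε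
    obtain ⟨a, ha, ha'⟩ := h₁ M (ε / 2) (half_pos hε)
    obtain ⟨b, hb, hb'⟩ := h₂ M (ε / 2) (half_pos hε)
    refine ⟨a ⊕ₘ b, fun N => ?_, ?_⟩
    · have h1 : (hat A a N : ℝ) ≤ o₁ N := ha N
      have h2 : (hat A b N : ℝ) ≤ o₂ N := hb N
      rw [(hat A).map_oplus']
      change ((hat A a N ⊕ₘ hat A b N : unitInterval) : ℝ) ≤ (o₁ N ⊕ₘ o₂ N : unitInterval)
      rw [unitInterval.coe_oplus, unitInterval.coe_oplus]
      exact min_le_min_left _ (by linarith)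
    · rw [(hat A).map_oplus']
      change ((o₁ M ⊕ₘ o₂ M : unitInterval) : ℝ) - ε ≤ (hat A a M ⊕ₘ hat A b M : unitInterval)
      rw [unitInterval.coe_oplus, unitInterval.coe_oplus]
      grind
  inf_mem o₁ h₁ o₂ h₂ := by
    rw [mem_maxOpens_iff] at *
    intro M ε hε
    obtain ⟨a, ha, ha'⟩ := h₁ M ε hε
    obtain ⟨b, hb, hb'⟩ := h₂ M ε hε
    -- `a ∧ b = a ⊙ (a* ⊕ b)`
    have key : ∀ N, (hat A (a ⊙ₘ (∼a ⊕ₘ b)) N : ℝ) = min (hat A a N : ℝ) (hat A b N) := by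
      intro N
      rw [(hat A).map_odot, (hat A).map_oplus', (hat A).map_neg']
      change ((hat A a N ⊙ₘ (∼(hat A a N) ⊕ₘ hat A b N) : unitInterval) : ℝ) = _
      rw [unitInterval.coe_odot, unitInterval.coe_oplus, unitInterval.coe_neg]
      have := (hat A a N).2.1; have := (hat A b N).2.1; have := (hat A a N).2.2
      grind
    refine ⟨a ⊙ₘ (∼a ⊕ₘ b), fun N => ?_, ?_⟩
    · have h1 : (hat A a N : ℝ) ≤ o₁ N := ha N
      have h2 : (hat A b N : ℝ) ≤ o₂ N := hb N
      refine le_inf ?_ ?_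
      · change (_ : ℝ) ≤ _
        rw [key]; exact (min_le_left _ _).trans h1
      · change (_ : ℝ) ≤ _
        rw [key]; exact (min_le_right _ _).trans h2
    · rw [key]
      have h1 : ((o₁ ⊓ o₂) M : ℝ) ≤ o₁ M := (inf_le_left : o₁ ⊓ o₂ ≤ o₁) M
      have h2 : ((o₁ ⊓ o₂) M : ℝ) ≤ o₂ M := (inf_le_right : o₁ ⊓ o₂ ≤ o₂) M
      exact le_min (by linarith) (by linarith)

end maxTopology

/-! ### The categories and the functors `Max` and `Clop` -/

/-- Bundled MV-algebras. -/
structure MVAlg where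
  carrier : Type u
  [str : MVAlgebra carrier]

attribute [instance] MVAlg.str

instance : CoeSort MVAlg.{u} (Type u) := ⟨MVAlg.carrier⟩

/-- The category `MV` of MV-algebras and their homomorphisms. -/
instance : Category MVAlg.{u} where
  Hom A B := MVHom A B
  id A := MVHom.id A
  comp f g := g.comp f

/-- Bundled MV-topological spaces. -/
structure MVTopSpace where
  carrier : Type u
  top : MVTopology carrier

/-- Continuous maps: the preimage `o ∘ f` of an open fuzzy set is open. -/
@[ext]
structure MVContinuousMap (σ τ : MVTopSpace.{u}) where
  toFun : σ.carrier → τ.carrier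
  continuous : ∀ o ∈ τ.top.opens, o ∘ toFun ∈ σ.top.opens

/-- The category of MV-topological spaces and continuous maps. -/
instance : Category MVTopSpace.{u} where
  Hom σ τ := MVContinuousMap σ τ
  id _ := ⟨fun x => x, fun _ h => h⟩
  comp f g := ⟨fun x => g.toFun (f.toFun x), fun o h => f.continuous _ (g.continuous o h)⟩

/-- The contravariant functor `Max`: `A ↦ ⟨Max A, Ω_A⟩` and `Max h (N) = h⁻¹[N]`. -/
def maxFunctor : MVAlg.{u} ⥤ MVTopSpace.{u}ᵒᵖ where
  obj A := Opposite.op ⟨MaxSpec A, maxTopology A⟩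
  map {A B} h := Quiver.Hom.op (X := (⟨MaxSpec B, maxTopology B⟩ : MVTopSpace.{u}))
    (Y := (⟨MaxSpec A, maxTopology A⟩ : MVTopSpace.{u}))
    { toFun := MaxSpec.comap h
      continuous := by
        intro o ho
        refine mem_maxOpens_iff.2 fun N ε hε => ?_
        obtain ⟨a, ha, ha'⟩ := mem_maxOpens_iff.1 ho (MaxSpec.comap h N) ε hε
        have key : ∀ N', hat B (h.toFun a) N' = hat A a (MaxSpec.comap h N') := fun N' =>
          (MaxSpec.eval_comap h N' a).symm
        refine ⟨h.toFun a, fun N' => ?_, ?_⟩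
        · rw [key]; exact ha _
        · rw [key]; exact ha' }
  map_id _ := rfl
  map_comp _ _ := rfl

/-- The contravariant functor `Clop`: `τ ↦ Clop τ` and `Clop f (α) = α ∘ f`. -/
def clopFunctor : MVTopSpace.{u}ᵒᵖ ⥤ MVAlg.{u} where
  obj τ := ⟨τ.unop.top.clop⟩
  map {τ σ} f :=
    { toFun := fun α => ⟨α.1 ∘ f.unop.toFun, f.unop.continuous _ α.2.1, by
        obtain ⟨o, ho, h⟩ := α.2.2
        exact ⟨o ∘ f.unop.toFun, f.unop.continuous _ ho, by rw [h]; rfl⟩⟩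
      map_zero' := rfl
      map_neg' := fun _ => rfl
      map_oplus' := fun _ _ => rfl }
  map_id _ := rfl
  map_comp _ _ := rfl

/-- The class of semisimple MV-algebras. -/
def semisimpleMV : ObjectProperty MVAlg.{u} := fun A => IsSemisimpleMV A

/-- The class of lcc MV-algebras. -/
def lccMV : ObjectProperty MVAlg.{u} := fun A => IsLccMV A

theorem lccMV_le : lccMV.{u} ≤ semisimpleMV.{u} := fun _ h => h.1

/-- The category of semisimple MV-algebras, a full subcategory of `MV`. -/
abbrev MVss := semisimpleMV.{u}.FullSubcategory

/-- The category of lcc MV-algebras, a full subcategory of `MVss`. -/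
abbrev MVlcc := lccMV.{u}.FullSubcategory

/-- The inclusion functor. -/
abbrev lccInclusion : MVlcc.{u} ⥤ MVss.{u} := ObjectProperty.ιOfLE lccMV_le

/-- `Clop Max` on semisimple MV-algebras: `A ↦ Clop Max A` and `f ↦ Clop Max f`. -/
abbrev clopMax : MVss.{u} ⥤ MVAlg.{u} := semisimpleMV.ι ⋙ maxFunctor ⋙ clopFunctor

end standard

noncomputable section clopen

open MVAlgebra

/-! A fuzzy set `γ` on `MaxSpec A` is open exactly when at each point it is approximated by some
`hat A a ≤ γ`, and closed exactly when it is likewise approximated by some `hat A b ≥ γ`. A clopen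
`γ` is therefore a gap in `A` whose two sides come arbitrarily close at every point of the spectrum.
Any value at `M` lying between the two sides must equal `γ M` (`eq_of_hat_le_of_le_hat`). Everything
rests on this squeeze.

Let `h : A → B` be a homomorphism into an lcc algebra. At a maximal ideal `N` of `B` the images of
the two sides take the values that the sides take at the preimage of `N`. So they still come
together, the cut generated by the lower side is a limit cut of `B`, and its supremum separates the
images (`IsLccMV.exists_between`). If `B` is an lcc subalgebra of fuzzy sets containing all `hat A
a`, the separating element is `γ` itself by the squeeze, so `B` contains every clopen. If `h` is the
identity, it follows that an lcc algebra is isomorphic to its algebra of clopens.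

Conversely the clopens form an lcc algebra (`isLccMV_clop`). The pointwise join of a limit cut is
open as a join of opens, and it is closed because the upper bounds of the cut approach it at every
point. Hence the clopens are the least lcc subalgebra containing the image of `hat A`, that is, the
limit cut completion (`isLeast_clop`).

For the adjunction, the unit is `a ↦ hat A a` and the counit is its inverse on lcc algebras. The
nontrivial triangle identity says that every maximal ideal of the clopen algebra evaluates clopens
at a point of `MaxSpec A` (`eval_clop`), which is the squeeze once more. Faithfulness comes from
naturality and injectivity of the unit on semisimple algebras. -/

/-! ### Order, distance and kernels in algebras of fuzzy sets. -/

theorem unitInterval.mvle_iff {x y : unitInterval} : x ≤ₘ y ↔ x ≤ y := by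
  rw [MVAlgebra.le, Subtype.ext_iff, unitInterval.coe_oplus, unitInterval.coe_mvone,
    unitInterval.coe_neg, min_eq_left_iff, ← Subtype.coe_le_coe]
  constructor <;> intro h <;> linarith

theorem FuzzySet.mvle_iff {X : Type u} {α β : FuzzySet X} : α ≤ₘ β ↔ α ≤ β :=
  ⟨fun h x => unitInterval.mvle_iff.1 (congrFun h x),
    fun h => funext fun x => unitInterval.mvle_iff.2 (h x)⟩

theorem MVSubalgebra.mvle_iff {X : Type u} {B : MVSubalgebra (FuzzySet X)} {a b : B} :
    a ≤ₘ b ↔ a.1 ≤ b.1 :=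
  ⟨fun h => FuzzySet.mvle_iff.1 (congrArg Subtype.val h),
    fun h => Subtype.ext (FuzzySet.mvle_iff.2 h)⟩

theorem unitInterval.coe_dist (x y : unitInterval) :
    ((MVAlgebra.dist x y : unitInterval) : ℝ) = |(x : ℝ) - y| := by
  rw [MVAlgebra.dist, MVAlgebra.ominus, MVAlgebra.ominus, unitInterval.coe_oplus,
    unitInterval.coe_odot, unitInterval.coe_odot, unitInterval.coe_neg, unitInterval.coe_neg]
  have := x.2.1; have := y.2.1; have := x.2.2; have := y.2.2
  grind

theorem MVHom.map_ominus {A : Type u} {B : Type v} [MVAlgebra A] [MVAlgebra B] (f : MVHom A B)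
    (x y : A) : f (x ⊖ₘ y) = f x ⊖ₘ f y := by
  rw [ominus, f.map_odot, f.map_neg', ominus]

/-- Equal images force both differences `x ⊖ₘ y` and `y ⊖ₘ x` into the kernel, and their vanishing
gives the two inequalities. -/
theorem MVHom.injective_of_ker {A : Type u} {B : Type v} [MVAlgebra A] [MVAlgebra B]
    (f : MVHom A B) (hf : ∀ a, f a = zero → a = zero) : Function.Injective f.toFun := by
  intro x y hxy
  refine MVAlgebra.le_antisymm (ominus_eq_zero_iff.1 (hf _ ?_)) (ominus_eq_zero_iff.1 (hf _ ?_)) <;>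
  · rw [f.map_ominus, hxy, ominus_self]

/-- The inclusion of a subalgebra. -/
def MVSubalgebra.subtype {A : Type u} [MVAlgebra A] (B : MVSubalgebra A) : MVHom B A :=
  ⟨Subtype.val, rfl, fun _ => rfl, fun _ _ => rfl⟩

/-- Evaluation of fuzzy sets at a point. -/
def FuzzySet.evalHom {X : Type u} (x : X) : MVHom (FuzzySet X) unitInterval :=
  ⟨fun α => α x, rfl, fun _ => rfl, fun _ _ => rfl⟩

/-! ### Points of the maximal spectrum and semisimplicity. -/

section

variable {A : Type u} [MVAlgebra A]

/-- The kernel of a homomorphism to `[0, 1]`, as a point of the maximal spectrum. -/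
def MaxSpec.ofHom (φ : MVHom A unitInterval) : MaxSpec A :=
  ⟨{ carrier := {a | φ a = zero}
     zero_mem := φ.map_zero'
     oplus_mem := fun x hx y hy => by
      rw [Set.mem_ofPred_eq] at *
      rw [φ.map_oplus', hx, hy, oplus_zero]
     lower := fun x y hxy hy => by
      rw [Set.mem_ofPred_eq] at *
      exact le_zero (hy ▸ φ.map_le hxy) }, isMaximal_of_ker φ _ fun _ => Iff.rfl⟩

/-- This turns point evaluations of an algebra of fuzzy sets into elements of its maximal spectrum
with known values. -/
theorem MaxSpec.eval_ofHom (φ : MVHom A unitInterval) : (MaxSpec.ofHom φ).eval = φ :=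
  MVHom.eq_of_ker_eq fun a => (MaxSpec.ofHom φ).eval_eq_zero_iff a

/-- Every nonzero element of the quotient has a multiple equal to `1`, so an ideal containing one is
not proper. -/
theorem MVIdeal.IsMaximal.isSimpleMV {M : MVIdeal A} (hM : M.IsMaximal) :
    IsSimpleMV M.Quotient := by
  have h01 := hM.isMVChain.zero_ne_one
  intro I
  rw [MVIdeal.isProper_iff]
  constructor
  · intro hI
    refine Set.Subset.antisymm (fun b hb => ?_) (Set.singleton_subset_iff.2 I.zero_mem)
    by_contra hb0
    obtain ⟨n, hn⟩ := hM.exists_mul_quotient b hb0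
    exact hI (hn ▸ I.mul_mem hb n)
  · intro hI h
    rw [hI] at h
    exact h01 (Set.mem_singleton_iff.1 h).symm

theorem hat_apply (a : A) (M : MaxSpec A) : hat A a M = M.eval a := rfl

/-- In a subdirect product of simple algebras the kernels of the coordinates are maximal ideals, so
an element lying in all maximal ideals has all coordinates zero. Conversely, an injective `hat A`
makes `A` a subdirect product of its quotients by maximal ideals. -/
theorem isSemisimpleMV_iff : IsSemisimpleMV A ↔ Function.Injective (hat A).toFun := by
  constructor
  · rintro ⟨X, S, _, f, hS, hf, -⟩
    refine (hat A).injective_of_ker fun a ha => hf (funext fun i => ?_)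
    rw [f.map_zero']
    let I : MVIdeal (S i) :=
      { carrier := {zero}
        zero_mem := rfl
        oplus_mem := by rintro _ rfl _ rfl; exact oplus_zero _
        lower := by rintro x _ hx rfl; exact le_zero hx }
    -- Simplicity of the factor says exactly that its zero ideal is maximal.
    have hI : I.IsMaximal := ⟨(hS i I).2 rfl, fun J hJ _ => MVIdeal.ext ((hS i J).1 hJ)⟩
    let g : MVHom A (S i) := ⟨fun a => f a i, congrFun f.map_zero' i,
      fun x => congrFun (f.map_neg' x) i, fun x y => congrFun (f.map_oplus' x y) i⟩
    let N : MaxSpec (S i) := ⟨I, hI⟩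
    have h : (N.comap g).eval a = zero := congrFun ha (N.comap g)
    rw [MaxSpec.eval_comap] at h
    exact ((N.eval_eq_zero_iff _).1 h :)
  · intro h
    refine ⟨MaxSpec A, fun M => M.1.Quotient, fun M => inferInstance,
      ⟨fun a M => M.1.proj a, rfl, fun _ => rfl, fun _ _ => rfl⟩, fun M => M.2.isSimpleMV,
      fun a b hab => h (funext fun M => ?_), fun M => M.1.proj_surjective⟩
    exact congrArg M.embedding.toFun (congrFun hab M)

/-- The points of `X` give homomorphisms to `[0, 1]`, hence maximal ideals, and these already
separate fuzzy sets. -/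
theorem MVSubalgebra.isSemisimpleMV {X : Type u} (B : MVSubalgebra (FuzzySet X)) :
    IsSemisimpleMV B := by
  refine isSemisimpleMV_iff.2 fun a b hab => Subtype.ext (funext fun x => ?_)
  have h := congrFun hab (MaxSpec.ofHom ((FuzzySet.evalHom x).comp B.subtype))
  change hat _ a _ = hat _ b _ at h
  rwa [hat_apply, hat_apply, MaxSpec.eval_ofHom] at h

/-! ### Clopen fuzzy sets as gaps in the base. -/

/-- Dual to the description of opens in `mem_maxOpens_iff`: the complement of `γ` is open, and
complements of its lower approximations are upper approximations of `γ`. -/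
theorem exists_le_hat {γ : FuzzySet (MaxSpec A)} (hγ : γ ∈ (maxTopology A).clop.carrier)
    (M : MaxSpec A) {ε : ℝ} (hε : 0 < ε) : ∃ b, γ ≤ hat A b ∧ (hat A b M : ℝ) ≤ γ M + ε := by
  obtain ⟨a, ha, ha'⟩ :=
    mem_maxOpens_iff.1 ((maxTopology A).clop.neg_mem γ hγ).1 M ε hε
  refine ⟨∼a, fun N => ?_, ?_⟩ <;> rw [(hat A).map_neg']
  · have h : (hat A a N : ℝ) ≤ 1 - γ N := ha N
    change (γ N : ℝ) ≤ 1 - hat A a N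
    linarith
  · change 1 - (γ M : ℝ) - ε ≤ hat A a M at ha'
    change 1 - (hat A a M : ℝ) ≤ _
    linarith

/-- A clopen fuzzy set is determined pointwise by the elements of `Â` below and above it. -/
theorem eq_of_hat_le_of_le_hat {γ : FuzzySet (MaxSpec A)}
    (hγ : γ ∈ (maxTopology A).clop.carrier) (M : MaxSpec A) {t : unitInterval}
    (h₁ : ∀ a, hat A a ≤ γ → hat A a M ≤ t) (h₂ : ∀ b, γ ≤ hat A b → t ≤ hat A b M) :
    t = γ M := by
  refine _root_.le_antisymm ?_ ?_
  · refine Subtype.coe_le_coe.1 (le_of_forall_pos_le_add fun ε hε => ?_)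
    obtain ⟨b, hb, hb'⟩ := exists_le_hat hγ M hε
    exact (Subtype.coe_le_coe.2 (h₂ b hb)).trans hb'
  · refine Subtype.coe_le_coe.1 (le_of_forall_pos_le_add fun ε hε => ?_)
    obtain ⟨a, ha, ha'⟩ := mem_maxOpens_iff.1 hγ.1 M ε hε
    have := Subtype.coe_le_coe.2 (h₁ a ha)
    linarith

theorem hat_mem_clop (a : A) : hat A a ∈ (maxTopology A).clop.carrier :=
  ⟨hat_mem_maxOpens a, hat A ∼a, hat_mem_maxOpens _, by
    rw [(hat A).map_neg', MVAlgebra.neg_neg]⟩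

variable (A) in
/-- The homomorphism `A → Clop Max A`, `a ↦ â`. -/
def hatClop : MVHom A (maxTopology A).clop where
  toFun a := ⟨hat A a, hat_mem_clop a⟩
  map_zero' := Subtype.ext (hat A).map_zero'
  map_neg' x := Subtype.ext ((hat A).map_neg' x)
  map_oplus' x y := Subtype.ext ((hat A).map_oplus' x y)

/-- Every homomorphism `Clop Max A → [0, 1]` is the evaluation at a maximal ideal of `A`. -/
theorem eval_clop (N : MaxSpec (maxTopology A).clop) (γ : (maxTopology A).clop) :
    N.eval γ = γ.1 (N.comap (hatClop A)) := by
  -- `N.eval` is monotone and on elements of `A` agrees with evaluation at the pulled back point, so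
  -- its value at `γ` is squeezed.
  refine eq_of_hat_le_of_le_hat γ.2 _ (fun a ha => ?_) (fun b hb => ?_) <;>
  rw [hat_apply, MaxSpec.eval_comap] <;>
  refine unitInterval.mvle_iff.1 (N.eval.map_le (MVSubalgebra.mvle_iff.2 ?_))
  exacts [ha, hb]

/-! ### Clopens and limit cuts. -/

theorem upperSet_lowerSet_upperSet (S : Set A) : upperSet (lowerSet (upperSet S)) = upperSet S :=
  Set.Subset.antisymm (fun _ hb a ha => hb a fun _ hc => hc a ha) fun b hb _ ha => ha b hb

/-- In an lcc algebra `B`, the image under `h : A → B` of the cut of `A` determined by a clopen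
fuzzy set is filled. -/
theorem IsLccMV.exists_between {B : Type u} [MVAlgebra B] (hB : IsLccMV B) (h : MVHom A B)
    {γ : FuzzySet (MaxSpec A)} (hγ : γ ∈ (maxTopology A).clop.carrier) :
    ∃ s : B, (∀ a, hat A a ≤ γ → h a ≤ₘ s) ∧ ∀ b, γ ≤ hat A b → s ≤ₘ h b := by
  set S : Set B := {s | ∃ a, hat A a ≤ γ ∧ h a = s} with hS
  -- The comparison takes place in `MaxSpec A`, at the preimage of `N`. Thus `a ≤ₘ b` in `A` is not
  -- needed, and `A` may fail to be semisimple.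
  have hu : ∀ b, γ ≤ hat A b → ∀ a, hat A a ≤ γ → ∀ N : MaxSpec B,
      (N.eval (h a) : ℝ) ≤ N.eval (h b) := by
    intro b hb a ha N
    rw [← MaxSpec.eval_comap, ← MaxSpec.eval_comap]
    exact (ha.trans hb) _
  have hinj := isSemisimpleMV_iff.1 hB.1
  -- Semisimplicity of `B` lets its order be tested at the maximal ideals.
  have hle : ∀ x y : B, (∀ N : MaxSpec B, (N.eval x : ℝ) ≤ N.eval y) → x ≤ₘ y := by
    intro x y hxy
    refine hinj ((hat B).map_one.symm ▸ ?_)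
    rw [(hat B).map_oplus', (hat B).map_neg']
    exact FuzzySet.mvle_iff.2 hxy
  have hT : ∀ b, γ ≤ hat A b → h b ∈ upperSet S := by
    rintro b hb _ ⟨a, ha, rfl⟩
    exact hle _ _ (hu b hb a ha)
  -- `S` itself need not be a cut; its closure is one and has the same upper bounds, hence the same
  -- supremum.
  obtain ⟨s, hs, hs'⟩ := hB.2 (lowerSet (upperSet S)) ⟨by
    rw [IsCut, upperSet_lowerSet_upperSet], by
    rw [upperSet_lowerSet_upperSet]
    refine funext fun N => Subtype.ext (_root_.le_antisymm ?_ (unitInterval.mvle_iff.1 (MVAlgebra.zero_le _)))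
    refine le_of_forall_pos_le_add fun ε hε => ?_
    obtain ⟨a, ha, ha'⟩ := mem_maxOpens_iff.1 hγ.1 (N.comap h) (ε / 2) (half_pos hε)
    obtain ⟨b, hb, hb'⟩ := exists_le_hat hγ (N.comap h) (half_pos hε)
    have hmem : MVAlgebra.dist (hat B (h a)) (hat B (h b)) ∈ {α : FuzzySet (MaxSpec B) |
        ∃ a ∈ lowerSet (upperSet S), ∃ b ∈ upperSet S,
          α = MVAlgebra.dist (hat B a) (hat B b)} :=
      ⟨h a, fun _ hc => hc _ ⟨a, ha, rfl⟩, h b, hT b hb, rfl⟩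
    -- One pair suffices for each `ε`: the values of `h a` and `h b` at `N` lie on either side of
    -- that of `γ` at the preimage of `N`, each within `ε / 2` of it.
    refine (Subtype.coe_le_coe.2 (sInf_le hmem N)).trans ?_
    change ((MVAlgebra.dist (hat B (h a) N) (hat B (h b) N) : unitInterval) : ℝ) ≤ 0 + ε
    have h1 := hu b hb a ha N
    rw [unitInterval.coe_dist, hat_apply, hat_apply, abs_le]
    rw [hat_apply, MaxSpec.eval_comap] at ha' hb'
    constructor <;> linarith⟩
  rw [upperSet_lowerSet_upperSet] at hs hs'
  exact ⟨s, fun a ha => hs _ ⟨a, ha, rfl⟩, fun b hb => hs' _ (hT b hb)⟩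

-- The supremum is the join taken among all fuzzy sets; the limit condition is what makes this join
-- closed.
variable (A) in
theorem isLccMV_clop : IsLccMV (maxTopology A).clop := by
  refine ⟨MVSubalgebra.isSemisimpleMV _, fun Z hZ => ?_⟩
  have hgap : ∀ (M : MaxSpec A) (ε : ℝ), 0 < ε →
      ∃ a ∈ Z, ∃ b ∈ upperSet Z, (b.1 M : ℝ) ≤ a.1 M + ε := by
    intro M ε hε
    -- The limit condition speaks of the spectrum of the clopen algebra. The point `M` embeds there
    -- as `N`, where evaluation is evaluation at `M`.
    set N := MaxSpec.ofHom ((FuzzySet.evalHom M).comp (maxTopology A).clop.subtype) with hN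
    have h := congrFun hZ.2 N
    by_contra! hcon
    have hle : min ε 1 ≤ ((MVAlgebra.zero : unitInterval) : ℝ) := by
      -- If all gaps at `M` exceeded `ε`, this would be a positive lower bound of the distances. The
      -- minimum with `1` keeps it in the interval when `ε` is large.
      let e : unitInterval := ⟨min ε 1, le_min hε.le zero_le_one, min_le_right _ _⟩
      change e ≤ (MVAlgebra.zero : unitInterval)
      change _ = (MVAlgebra.zero : unitInterval) at h
      rw [← h, sInf_apply]
      refine le_iInf ?_
      rintro ⟨_, a, ha, b, hb, rfl⟩
      have h1 := hcon a ha b hb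
      change min ε 1 ≤ ((MVAlgebra.dist (hat _ a N) (hat _ b N) : unitInterval) : ℝ)
      rw [unitInterval.coe_dist, hat_apply, hat_apply, hN, MaxSpec.eval_ofHom]
      change min ε 1 ≤ |(a.1 M : ℝ) - b.1 M|
      refine (min_le_left _ _).trans (le_trans ?_ (neg_le_abs _))
      linarith
    rw [unitInterval.coe_mvzero] at hle
    exact absurd (lt_min hε one_pos) (not_lt.2 hle)
  set γ : FuzzySet (MaxSpec A) := sSup (Subtype.val '' Z) with hγ
  have hlow : ∀ a ∈ Z, a.1 ≤ γ := fun a ha => le_sSup ⟨a, ha, rfl⟩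
  have hupp : ∀ b ∈ upperSet Z, γ ≤ b.1 := by
    rintro b hb
    refine sSup_le ?_
    rintro _ ⟨a, ha, rfl⟩
    exact MVSubalgebra.mvle_iff.1 (hb a ha)
  have hopen : γ ∈ (maxTopology A).opens := by
    refine (maxTopology A).sSup_mem _ ?_
    rintro _ ⟨a, -, rfl⟩
    exact a.2.1
  have hclosed : ∼γ ∈ (maxTopology A).opens := by
    refine mem_maxOpens_iff.2 fun M ε hε => ?_
    -- Half of `ε` pays for replacing `γ` by an upper bound `b` near `M`, the other half for
    -- approximating the open complement of `b` by some `hat A c`.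
    obtain ⟨a, ha, b, hb, hab⟩ := hgap M (ε / 2) (half_pos hε)
    obtain ⟨c, hc, hc'⟩ := mem_maxOpens_iff.1 ((maxTopology A).clop.neg_mem _ b.2).1 M (ε / 2)
      (half_pos hε)
    refine ⟨c, hc.trans (FuzzySet.mvle_iff.1
      (MVAlgebra.neg_le_neg (FuzzySet.mvle_iff.2 (hupp b hb)))), ?_⟩
    have h1 : (a.1 M : ℝ) ≤ γ M := hlow a ha M
    change 1 - (b.1 M : ℝ) - ε / 2 ≤ _ at hc'
    change 1 - (γ M : ℝ) - ε ≤ _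
    linarith
  exact ⟨⟨γ, hopen, ∼γ, hclosed, (MVAlgebra.neg_neg γ).symm⟩,
    fun a ha => MVSubalgebra.mvle_iff.2 (hlow a ha),
    fun b hb => MVSubalgebra.mvle_iff.2 (hupp b hb)⟩

-- Minimality holds because an lcc subalgebra containing the base must fill the gap of each clopen
-- `γ`, and only `γ` fits there.
variable (A) in
theorem isLeast_clop : IsLeast (lccSubalgebras A) (maxTopology A).clop := by
  refine ⟨⟨isLccMV_clop A, ?_⟩, ?_⟩
  · rintro _ ⟨a, rfl⟩
    exact hat_mem_clop a
  · rintro B ⟨hB, hAB⟩ γ hγ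
    -- The map `hat A` with its codomain cut down to `B`.
    let h : MVHom A B := ⟨fun a => ⟨hat A a, hAB ⟨a, rfl⟩⟩, Subtype.ext (hat A).map_zero',
      fun x => Subtype.ext ((hat A).map_neg' x), fun x y => Subtype.ext ((hat A).map_oplus' x y)⟩
    obtain ⟨s, h₁, h₂⟩ := hB.exists_between h hγ
    have : s.1 = γ := funext fun M => eq_of_hat_le_of_le_hat hγ M
      (fun a ha => MVSubalgebra.mvle_iff.1 (h₁ a ha) M)
      (fun b hb => MVSubalgebra.mvle_iff.1 (h₂ b hb) M)
    exact this ▸ s.2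

variable (A) in
theorem limitCutCompletion_eq_clop : limitCutCompletion A = (maxTopology A).clop := by
  refine _root_.le_antisymm (fun x hx => ?_) fun x hx => ?_
  · exact Set.mem_iInter₂.1 hx _ (isLeast_clop A).1
  · exact Set.mem_iInter₂.2 fun B hB => (isLeast_clop A).2 hB hx

/-- For the identity homomorphism, the element filling the gap of `γ` lies in `A` itself, and its
image is squeezed onto `γ`. -/
theorem IsLccMV.hatClop_surjective (hA : IsLccMV A) : Function.Surjective (hatClop A).toFun := by
  intro γ
  obtain ⟨s, h₁, h₂⟩ := hA.exists_between (MVHom.id A) γ.2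
  exact ⟨s, Subtype.ext (funext fun M => eq_of_hat_le_of_le_hat γ.2 M
    (fun a ha => unitInterval.mvle_iff.1 (M.eval.map_le (h₁ a ha)))
    (fun b hb => unitInterval.mvle_iff.1 (M.eval.map_le (h₂ b hb))))⟩

theorem IsSemisimpleMV.hatClop_injective (hA : IsSemisimpleMV A) :
    Function.Injective (hatClop A).toFun :=
  fun _ _ hab => isSemisimpleMV_iff.1 hA (congrArg Subtype.val hab)

end

/-! ### The reflection: unit, counit, triangle identities and faithfulness. -/

section

/-- The inverse of a bijective homomorphism. -/
def MVHom.inverse {A : Type u} {B : Type v} [MVAlgebra A] [MVAlgebra B] (f : MVHom A B)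
    (hf : Function.Bijective f.toFun) : MVHom B A where
  toFun := (Equiv.ofBijective f.toFun hf).symm
  map_zero' := (Equiv.symm_apply_eq _).2 f.map_zero'.symm
  map_neg' x := (Equiv.symm_apply_eq _).2 <| by
    change _ = f.toFun _
    rw [f.map_neg']
    exact congrArg _ ((Equiv.ofBijective f.toFun hf).apply_symm_apply x).symm
  map_oplus' x y := (Equiv.symm_apply_eq _).2 <| by
    change _ = f.toFun _
    rw [f.map_oplus']
    exact congrArg₂ _ ((Equiv.ofBijective f.toFun hf).apply_symm_apply x).symm
      ((Equiv.ofBijective f.toFun hf).apply_symm_apply y).symm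

theorem MVHom.apply_inverse {A : Type u} {B : Type v} [MVAlgebra A] [MVAlgebra B] (f : MVHom A B)
    (hf : Function.Bijective f.toFun) (b : B) : f (f.inverse hf b) = b :=
  (Equiv.ofBijective f.toFun hf).apply_symm_apply b

theorem MVHom.inverse_apply {A : Type u} {B : Type v} [MVAlgebra A] [MVAlgebra B] (f : MVHom A B)
    (hf : Function.Bijective f.toFun) (a : A) : f.inverse hf (f a) = a :=
  (Equiv.ofBijective f.toFun hf).symm_apply_apply a

theorem lccMV_clopMax (A : MVss.{u}) : lccMV (clopMax.obj A) := isLccMV_clop A.obj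

/-- The functor `A ↦ Clop Max A` into lcc algebras. -/
abbrev lccFunctor : MVss.{u} ⥤ MVlcc.{u} := lccMV.lift clopMax lccMV_clopMax

theorem IsLccMV.hatClop_bijective {A : Type u} [MVAlgebra A] (hA : IsLccMV A) :
    Function.Bijective (hatClop A).toFun :=
  ⟨hA.1.hatClop_injective, hA.hatClop_surjective⟩

/-- This is the naturality of the unit; it is used again for the counit and for faithfulness. -/
theorem hat_map {A B : Type u} [MVAlgebra A] [MVAlgebra B] (f : MVHom A B) (a : A) :
    hat B (f a) = hat A a ∘ MaxSpec.comap f :=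
  funext fun N => (MaxSpec.eval_comap f N a).symm

/-- The unit `a ↦ â`. -/
def lccUnit : 𝟭 MVss.{u} ⟶ lccFunctor ⋙ lccInclusion where
  app A := ObjectProperty.homMk (hatClop A.obj)
  naturality A B f := by
    apply ObjectProperty.hom_ext
    exact MVHom.ext (funext fun a => Subtype.ext (hat_map f.hom a))

/-- The counit, inverse to `b ↦ b̂`. -/
def lccCounit : lccInclusion ⋙ lccFunctor ⟶ 𝟭 MVlcc.{u} where
  app B := ObjectProperty.homMk ((hatClop B.obj).inverse B.property.hatClop_bijective)
  naturality B C f := by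
    apply ObjectProperty.hom_ext
    -- Applying the injective `hatClop` of `C` removes the inverse on one side; writing `γ` as the
    -- image of some `b` removes it on the other.
    refine MVHom.ext (funext fun γ => C.property.hatClop_bijective.1 ?_)
    refine ((hatClop C.obj).apply_inverse C.property.hatClop_bijective _).trans ?_
    obtain ⟨b, rfl⟩ := B.property.hatClop_bijective.2 γ
    refine Subtype.ext ((hat_map f.hom b).symm.trans
      (congrArg (fun x => hat C.obj (f.hom.toFun x)) ?_))
    exact ((hatClop B.obj).inverse_apply B.property.hatClop_bijective b).symm

/-- The adjunction between `Clop Max` and the inclusion of lcc algebras. -/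
def lccAdjunction : lccFunctor.{u} ⊣ lccInclusion where
  unit := lccUnit
  counit := lccCounit
  left_triangle_components A := by
    apply ObjectProperty.hom_ext
    refine MVHom.ext (funext fun γ => ?_)
    have hC : IsLccMV (maxTopology A.obj).clop := isLccMV_clop A.obj
    refine Eq.trans (congrArg ((hatClop _).inverse hC.hatClop_bijective).toFun ?_)
      ((hatClop _).inverse_apply hC.hatClop_bijective γ)
    -- Pulling `γ` back along the spectrum of the unit gives the same fuzzy set as `hat` of the
    -- clopen algebra at `γ`, so the counit returns `γ`.
    exact Subtype.ext (funext fun N => (eval_clop N γ).symm)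
  right_triangle_components B := by
    apply ObjectProperty.hom_ext
    exact MVHom.ext (funext fun b =>
      (hatClop B.obj).inverse_apply B.property.hatClop_bijective b)

theorem lccFunctor_faithful : lccFunctor.{u}.Faithful where
  map_injective {A B f g} hfg := by
    apply ObjectProperty.hom_ext
    -- By naturality the functor's value on `f`, taken at the image of `a`, determines `hat` of `f
    -- a`, and `hat` is injective on the semisimple target.
    refine MVHom.ext (funext fun a => isSemisimpleMV_iff.1 B.property ?_)
    have h : (lccFunctor.map f).hom.toFun (hatClop A.obj a) =
      (lccFunctor.map g).hom.toFun (hatClop A.obj a) := by rw [hfg]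
    exact (hat_map f.hom a).trans ((congrArg Subtype.val h).trans (hat_map g.hom a).symm)

end

end clopen

theorem theorem5p7 :
    (∀ (A : Type u) [MVAlgebra A], IsSemisimpleMV A →
      IsLeast (lccSubalgebras A) (limitCutCompletion A) ∧
        limitCutCompletion A = (maxTopology A).clop) ∧
    ∃ h : ∀ A : MVss.{u}, lccMV (clopMax.obj A),
      (∀ A : MVss.{u}, ((lccMV.lift clopMax h).obj A).obj = ⟨limitCutCompletion A.obj⟩) ∧
      (lccMV.lift clopMax h).Faithful ∧
      ∃ adj : lccMV.lift clopMax h ⊣ lccInclusion,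
        ∀ (A : MVss.{u}) (a : A.obj), ((adj.unit.app A).hom.toFun a).1 = hat A.obj a := by
  refine ⟨fun A _ _ => ⟨limitCutCompletion_eq_clop A ▸ isLeast_clop A,
    limitCutCompletion_eq_clop A⟩, lccMV_clopMax, fun A => ?_, lccFunctor_faithful,
    lccAdjunction, fun A a => rfl⟩
  rw [limitCutCompletion_eq_clop]
  rfl
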